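/- Let $k,n\ge 1$. Let $\mathrm{SYT}(n^k)$ be the set of standard Young tableaux with $k$ rows and $n$ columns, let $\mathcal S_k$ be the set of permutations of $\{1,\dots,k\}$, and for $T\in\mathrm{SYT}(n^k)$ let $R_T(i)$ be the row of $T$ containing $i$. Write $\mathrm{asc}(T)=|\{i: R_T(i)>R_T(i+1)\}|$, $b_{r,s}(T)=|\{i:R_T(i)=r,\ R_T(i+1)=s\}|$ (with $1\le i\le kn-1$) and, for $\sigma\in\mathcal S_k$, $\mathrm{des}_\sigma(T)=\sum_{\sigma_r>\sigma_s}b_{r,s}(T)$. For a word $w$ (in particular for a permutation), $\mathrm{des}(w)=|\{i:w_i>w_{i+1}\}|$. For $\sigma\in\mathcal S_k$, let $\sigma^c_r=k+1-\sigma_r$. *The map $\alpha$.* The arrow encoding of $T$ is the array of sequences $A_{r,c}$ ($1\le r\le k$, $0\le c\le n$) over $\{\uparrow,\downarrow\}$ obtained as follows. Initially $A_{r,0}=\uparrow$ for $2\le r\le k$ and all other sequences are empty. For $i=1,\dots,kn-1$ in turn, let $\max_r^i$ be the number of entries $\le i$ in row $r$ of $T$; append $\downarrow$ to $A_{r,\max_r^i}$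 for all $r$ with $R_T(i)\le r<R_T(i+1)$, and append $\uparrow$ to $A_{r,\max_r^i}$ for all $r$ with $R_T(i)\ge r>R_T(i+1)$. Finally append $\downarrow$ to $A_{r,n}$ for $R_T(kn)\le r<k$. For $1\le r\le k-1$, $\alpha_r(T)$ is the tableau whose arrow encoding is obtained from that of $T$ by doing the following for every $0\le c\le n$: if $A_{r,c}$ ends with $\downarrow$ and $A_{r+1,c}$ starts with $\uparrow$, remove these two arrows; if $A_{r,c}$ does not end with $\downarrow$ and $A_{r+1,c}$ does not start with $\uparrow$, insert $\downarrow$ at the end of $A_{r,c}$ and $\uparrow$ at the beginning of $A_{r+1,c}$. Let $\alpha=\alpha_1\circ\cdots\circ\alpha_{k-1}$. *Canon permutations.* Let $\mathcal C^n_k$ be the set of words consisting of $n$ copies of each of $1,\dots,k$ such that the subsequence formed by the $j$th copies of the letters is the same for all $1\le j\le n$. Then: 1. The map $(\sigma,T)\mapsto \sigma_{R_T(1)}\sigma_{R_T(2)}\cdots\sigma_{R_T(kn)}$ is a bijection $\mathcal S_k\times\mathrm{SYT}(n^k)\to\mathcal C^n_k$. 2. The maps $\alpha_r$ are well defined: for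 each $1\le r\le k-1$ and each $T$ there is exactly one tableau in $\mathrm{SYT}(n^k)$ with the prescribed arrow encoding. 3. There are bijections $\varphi_\sigma:\mathrm{SYT}(n^k)\to\mathrm{SYT}(n^k)$ ($\sigma\in\mathcal S_k$) such that $$\mathrm{des}_\sigma(T)=\mathrm{asc}(\varphi_\sigma(T))+\mathrm{des}(\sigma)\qquad\text{for all }\sigma\in\mathcal S_k,\ T\in\mathrm{SYT}(n^k).\tag{$*$}$$ 4. For every family of bijections $(\varphi_\sigma)$ satisfying $(*)$, the map $\pi\mapsto\widehat\pi$ that sends the canon permutation of the pair $(\sigma,T)$ to that of the pair $\bigl(\sigma^c,\varphi_{\sigma^c}^{-1}(\alpha(\varphi_\sigma(T)))\bigr)$ is an involution on $\mathcal C^n_k$ that satisfies $$\mathrm{des}(\pi)+\mathrm{des}(\widehat\pi)=(k-1)n\qquad\text{for all }\pi\in\mathcal C^n_k.$$ In particular, for $0\le d\le (k-1)n$ it restricts to a bijection from $\{\pi\in\mathcal C^n_k:\mathrm{des}(\pi)=d\}$ to $\{\pi\in\mathcal C^n_k:\mathrm{des}(\pi)=(k-1)n-d\}$. 5. Consequently,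 for $0\le d\le (k-1)n$, the number of $\pi\in\mathcal C^n_k$ with $d$ descents equals the number with $(k-1)n-d$ descents. -/

import Mathlib

namespace CanonPerm

/-! Rows, columns and entries are indexed from `0`: the row `r`, the column `c` and the entry `i` of
the usual (one-based) convention are the elements `r - 1`, `c - 1`, `i - 1` of `Fin k`, `Fin n`,
`Fin (k * n)`. Likewise permutations of `{1, …, k}` are permutations of `Fin k`. -/

/-- Standard Young tableaux of rectangular shape `(n^k)`, that is, with `k` rows and `n` columns:
bijective fillings of the cells, increasing along rows and down columns. -/
@[ext]
structure RectSYT (k n : ℕ) where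
  entry : Fin k × Fin n ≃ Fin (k * n)
  row_lt : ∀ (r : Fin k) (c c' : Fin n), c < c' → entry (r, c) < entry (r, c')
  col_lt : ∀ (r r' : Fin k) (c : Fin n), r < r' → entry (r, c) < entry (r', c)

variable {k n : ℕ}

/-- The row `R_T(i)` of `T` that contains the entry `i`. -/
def RectSYT.rowOf (T : RectSYT k n) (i : Fin (k * n)) : Fin k := (T.entry.symm i).1

/-- The number of ascents: entries `i` lying in a row strictly lower than the row of `i + 1`. -/
def RectSYT.asc (T : RectSYT k n) : ℕ :=
  (Finset.univ.filter fun i : Fin (k * n) =>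
    ∃ h : i.val + 1 < k * n, T.rowOf ⟨i.val + 1, h⟩ < T.rowOf i).card

/-- The number `b_{r,s}(T)` of entries `i` in row `r` such that `i + 1` is in row `s`. -/
def RectSYT.bounce (T : RectSYT k n) (r s : Fin k) : ℕ :=
  (Finset.univ.filter fun i : Fin (k * n) =>
    ∃ h : i.val + 1 < k * n, T.rowOf i = r ∧ T.rowOf ⟨i.val + 1, h⟩ = s).card

/-- The statistic `des_σ`, the sum of `b_{r,s}` over all `r, s` with `σ_r > σ_s`. -/
def RectSYT.desPerm (σ : Equiv.Perm (Fin k)) (T : RectSYT k n) : ℕ :=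
  ∑ p ∈ Finset.univ.filter (fun p : Fin k × Fin k => σ p.2 < σ p.1), T.bounce p.1 p.2

/-- The number of descents of a word: positions `i` with `w_i > w_{i+1}`. -/
def wordDes {m k : ℕ} (w : Fin m → Fin k) : ℕ :=
  (Finset.univ.filter fun i : Fin m =>
    ∃ h : i.val + 1 < m, w ⟨i.val + 1, h⟩ < w i).card

/-- The complement `σ^c`, given by `σ^c_r = k + 1 - σ_r` in the one-based convention. -/
def permCompl (σ : Equiv.Perm (Fin k)) : Equiv.Perm (Fin k) := σ.trans Fin.revPerm

/-! ### Arrow encodings -/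

inductive Arrow
  | up
  | down
  deriving DecidableEq

/-- Arrays of arrow sequences `A_{r,c}`. The sequence `A_{r,c}` with `c ≥ 1` sits on the right border
of the `c`-th cell of row `r`, and `A_{r,0}` on the left border of the first cell of row `r`. (So the
column index is not shifted here, the row index is.) -/
abbrev ArrowArray (k n : ℕ) := Fin k → Fin (n + 1) → List Arrow

/-- `max_r^i`: the number of cells in row `r` that are filled with entries `≤ i`. As rows increase,
this is the (one-based) column of the rightmost such cell, and `0` if there is none. -/
def RectSYT.filled (T : RectSYT k n) (i : Fin (k * n)) (r : Fin k) : ℕ :=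
  (Finset.univ.filter fun c : Fin n => T.entry (r, c) ≤ i).card

/-- The row `R_T(i + 1)`; for the last entry `i = N` this is by convention the bottom row, so that the
arrows of the final step of the encoding (a `↓` in each row `r` with `R_T(N) ≤ r < k`) are
produced by the same rule as the others. -/
def RectSYT.nextRow (T : RectSYT k n) (i : Fin (k * n)) : ℕ :=
  if h : i.val + 1 < k * n then (T.rowOf ⟨i.val + 1, h⟩).val else k - 1

/-- The arrow (if any) that step `i` of the encoding appends to `A_{r,c}`. -/
def RectSYT.arrowAt (T : RectSYT k n) (r : Fin k) (c : Fin (n + 1)) (i : Fin (k * n)) :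
    Option Arrow :=
  if T.filled i r = c.val then
    if (T.rowOf i).val ≤ r.val ∧ r.val < T.nextRow i then some Arrow.down
    else if T.nextRow i < r.val ∧ r.val ≤ (T.rowOf i).val then some Arrow.up
    else none
  else none

/-- The arrow encoding of a tableau: initially `A_{r,0} = ↑` for every row but the first and all
other sequences are empty; then the arrows of the steps `i = 1, …, N` are appended in this order. -/
def RectSYT.encoding (T : RectSYT k n) : ArrowArray k n := fun r c =>
  (if 0 < r.val ∧ c.val = 0 then [Arrow.up] else []) ++
    (List.finRange (k * n)).filterMap (T.arrowAt r c)

/-- The rule for two vertically adjacent sequences `X` (above) and `Y` (below): if `X` ends with `↓`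
and `Y` starts with `↑`, remove these two arrows; if neither holds, insert `↓` at the end of `X` and
`↑` at the beginning of `Y`; otherwise change nothing. -/
def negSwap (X Y : List Arrow) : List Arrow × List Arrow :=
  if X.getLast? = some Arrow.down ∧ Y.head? = some Arrow.up then (X.dropLast, Y.tail)
  else if X.getLast? ≠ some Arrow.down ∧ Y.head? ≠ some Arrow.up then
    (X ++ [Arrow.down], Arrow.up :: Y)
  else (X, Y)

/-- The effect of `α_r` on arrow arrays: the above rule applied to `A_{r,c}`, `A_{r+1,c}` for every
column `c`. -/
def arrayStep (r : Fin (k - 1)) (A : ArrowArray k n) : ArrowArray k n := fun s c =>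
  let X := A ⟨r.val, by omega⟩ c
  let Y := A ⟨r.val + 1, by omega⟩ c
  if s.val = r.val then (negSwap X Y).1
  else if s.val = r.val + 1 then (negSwap X Y).2
  else A s c

open Classical in
/-- `α_r(T)` is the tableau whose arrow encoding is `arrayStep r` of that of `T`. (The value `T` in
the second branch is never used once this tableau is known to exist.) -/
noncomputable def alphaStep (r : Fin (k - 1)) (T : RectSYT k n) : RectSYT k n :=
  if h : ∃ T' : RectSYT k n, T'.encoding = arrayStep r T.encoding then h.choose else T

/-- `α = α_1 ∘ α_2 ∘ ⋯ ∘ α_{k-1}`. -/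
noncomputable def alpha (T : RectSYT k n) : RectSYT k n :=
  (List.finRange (k - 1)).foldr alphaStep T

/-! ### Canon permutations -/

/-- The subsequence of `w` formed by the `j`-th copies of the letters (`j` counted from `0`). -/
def copySubword {m k : ℕ} (w : Fin m → Fin k) (j : ℕ) : List (Fin k) :=
  ((List.finRange m).filter fun p =>
    decide ((Finset.univ.filter fun q : Fin m => q < p ∧ w q = w p).card = j)).map w

/-- The set `C^n_k` of canon permutations: words with `n` copies of each of the `k` letters, in which
the subsequences of the `j`-th copies are the same for all `j`. -/
def canonPerms (k n : ℕ) : Set (Fin (k * n) → Fin k) :=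
  {w | (∀ a : Fin k, (Finset.univ.filter fun p => w p = a).card = n) ∧
    ∀ i j : ℕ, i < n → j < n → copySubword w i = copySubword w j}

/-- The word `σ_{R_T(1)} σ_{R_T(2)} ⋯ σ_{R_T(kn)}` of a pair `(σ, T)`. -/
def canonWord (p : Equiv.Perm (Fin k) × RectSYT k n) : Fin (k * n) → Fin k :=
  fun i => p.1 (p.2.rowOf i)

/-- `φ` is a family of bijections `φ_σ` of the tableaux, indexed by the permutations `σ`, with
`des_σ(T) = asc(φ_σ(T)) + des(σ)` for all `σ` and `T`. -/
def IsDescentFamily (φ : Equiv.Perm (Fin k) → Equiv.Perm (RectSYT k n)) : Prop :=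
  ∀ (σ : Equiv.Perm (Fin k)) (T : RectSYT k n), T.desPerm σ = (φ σ T).asc + wordDes σ

/-- The pair `(σ, T)` is sent to `(σ^c, φ_{σ^c}⁻¹(α(φ_σ(T))))`. -/
noncomputable def pairHat (φ : Equiv.Perm (Fin k) → Equiv.Perm (RectSYT k n))
    (p : Equiv.Perm (Fin k) × RectSYT k n) : Equiv.Perm (Fin k) × RectSYT k n :=
  (permCompl p.1, (φ (permCompl p.1)).symm (alpha (φ p.1 p.2)))

open Classical in
/-- The map `π ↦ π̂`: if `π` is the word of the pair `p`, then `π̂` is the word of `pairHat φ p`.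
(Words that do not come from a pair, hence are not canon permutations, are irrelevant.) -/
noncomputable def canonHat (φ : Equiv.Perm (Fin k) → Equiv.Perm (RectSYT k n))
    (w : Fin (k * n) → Fin k) : Fin (k * n) → Fin k :=
  if h : ∃ p : Equiv.Perm (Fin k) × RectSYT k n, canonWord p = w then
    canonWord (pairHat φ h.choose)
  else w

end CanonPerm

namespace CanonPerm

variable {k n : ℕ}

/-! ### Tableaux as orders on the cells -/

/-! A tableau is a linear order on the cells that extends the product order. A pair (σ, T) can be
read off its word: the j-th copies of the letters spell σ, and letter and copy number at a position
name the cell. The word has des_σ(T) descents, so two facts about tableaux remain.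

Existence of the φ_σ is an equidistribution statement, proved with Stanley's (P, ω)-partitions.
Consider maps f on the cells, bounded by m, weakly increasing, and growing down the columns at the
descents of σ. Sorting the cells by (f, σ of the row, column) gives a tableau, so the number of such
f is a sum over T of numbers of maps on a chain that grow at the descents of the word of (σ, T)
(`card_growing_cells`). Subtracting the forced growth shows that the total depends only on m -
des(σ), and the summand of T only on m - des_σ(T). Comparison with σ = 1 and deconvolution show that
des_σ - des(σ) and asc are equidistributed.

For α, read T as a walk through the rows. While row s has c entries, its arrows alternate, so
A_{s,c} is an optional ↑, then j copies of ↓↑, then an optional ↓ (`RectSYT.encoding_eq_zigzag`). On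
such sequences the rule of α_r exchanges and negates two bits: "A_{r,c} ends with ↓" and "A_{r+1,c}
starts with ↑" (`negSwap_zigzag`). A tableau with the new bits is found by keeping the order of the
rows up to r and that of the rows below, and changing only where the two are cut and shuffled
(`RectSYT.exists_recut`). The inequality that keeps columns increasing is invariant under the
negation (`RectSYT.exists_swap`). As encodings are injective, the α_r are commuting involutions.
Over the (k-1)(n+1) places, each kind of bit is true asc(T) + k - 1 times, and α turns one kind into
the negation of the other; hence asc(T) + asc(α(T)) = (k-1)(n-1). The missing k - 1 is des(σ) +
des(σ^c). -/

theorem RectSYT.exists_of_key (key : Fin k × Fin n → ℕ) (inj : Function.Injective key)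
    (hrow : ∀ (r : Fin k) (c c' : Fin n), c < c' → key (r, c) < key (r, c'))
    (hcol : ∀ (r r' : Fin k) (c : Fin n), r < r' → key (r, c) < key (r', c)) :
    ∃ T : RectSYT k n, ∀ p q, T.entry p < T.entry q ↔ key p < key q := by
  classical
  set S : Finset ℕ := Finset.univ.image key with hS
  have hcard : S.card = k * n := by
    rw [hS, Finset.card_image_of_injective _ inj]; simp
  have hmem : ∀ p, key p ∈ S := fun p => Finset.mem_image_of_mem _ (Finset.mem_univ _)
  let e : Fin k × Fin n → Fin (k * n) := fun p => (S.orderIsoOfFin hcard).symm ⟨key p, hmem p⟩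
  have hlt : ∀ p q, e p < e q ↔ key p < key q := fun p q => by simp [e]
  have hinj : Function.Injective e := fun p q h => by
    have := (S.orderIsoOfFin hcard).symm.injective h
    exact inj (by simpa using this)
  have hbij : Function.Bijective e :=
    (Fintype.bijective_iff_injective_and_card e).2 ⟨hinj, by simp⟩
  exact ⟨⟨Equiv.ofBijective e hbij, fun r c c' h => (hlt _ _).2 (hrow r c c' h),
    fun r r' c h => (hlt _ _).2 (hcol r r' c h)⟩, hlt⟩

/-- The order of the cells determines the filling, because the identity is the only order
automorphism of `Fin (k * n)`. -/
theorem RectSYT.ext_of_lt {T T' : RectSYT k n}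
    (h : ∀ p q, T.entry p < T.entry q → T'.entry p < T'.entry q) : T = T' := by
  have hs : StrictMono (fun i => T'.entry (T.entry.symm i)) := fun i j hij =>
    h _ _ (by simpa using hij)
  have := Subsingleton.elim (hs.orderIsoOfSurjective _
    (T'.entry.surjective.comp T.entry.symm.surjective)) (OrderIso.refl (Fin (k * n)))
  ext p : 2
  have h2 := congrArg (fun e => e (T.entry p)) this
  simp at h2
  exact h2.symm

theorem RectSYT.row_lt_iff (T : RectSYT k n) (r : Fin k) (c c' : Fin n) :
    T.entry (r, c) < T.entry (r, c') ↔ c < c' :=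
  (show StrictMono fun c => T.entry (r, c) from fun _ _ h => T.row_lt r _ _ h).lt_iff_lt

theorem RectSYT.le_of_le (T : RectSYT k n) {p q : Fin k × Fin n} (h : p ≤ q) :
    T.entry p ≤ T.entry q := by
  have h1 : T.entry (p.1, p.2) ≤ T.entry (p.1, q.2) :=
    (show StrictMono fun c => T.entry (p.1, c) from
      fun _ _ h => T.row_lt _ _ _ h).monotone h.2
  have h2 : T.entry (p.1, q.2) ≤ T.entry (q.1, q.2) :=
    (show StrictMono fun r => T.entry (r, q.2) from
      fun _ _ h => T.col_lt _ _ _ h).monotone h.1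
  exact h1.trans h2

instance : Finite (RectSYT k n) :=
  Finite.of_injective RectSYT.entry fun _ _ h => RectSYT.ext h

noncomputable instance : Fintype (RectSYT k n) := Fintype.ofFinite _

/-! ### Descents of words -/

/-- The number of descents of `w` at positions before `i`. -/
def desBefore {m k : ℕ} (w : Fin m → Fin k) (i : ℕ) : ℕ :=
  (Finset.univ.filter fun j : Fin m =>
    j.val < i ∧ ∃ h : j.val + 1 < m, w ⟨j.val + 1, h⟩ < w j).card

theorem desBefore_zero {m k : ℕ} (w : Fin m → Fin k) : desBefore w 0 = 0 := by
  simp [desBefore]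

theorem desBefore_last {m k : ℕ} (w : Fin m → Fin k) : desBefore w (m - 1) = wordDes w := by
  unfold desBefore wordDes
  congr 1
  ext j
  simp only [Finset.mem_filter, Finset.mem_univ, true_and, and_iff_right_iff_imp]
  rintro ⟨h, -⟩
  omega

theorem desBefore_mono {m k : ℕ} (w : Fin m → Fin k) : Monotone (desBefore w) := by
  intro a b hab
  refine Finset.card_le_card fun j => ?_
  simp only [Finset.mem_filter, Finset.mem_univ, true_and]
  exact fun h => ⟨by omega, h.2⟩

theorem desBefore_succ_of_lt {m k : ℕ} (w : Fin m → Fin k) (i : ℕ) (h : i + 1 < m)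
    (hd : w ⟨i + 1, h⟩ < w ⟨i, by omega⟩) : desBefore w (i + 1) = desBefore w i + 1 := by
  unfold desBefore
  rw [← Finset.card_insert_of_notMem (a := (⟨i, by omega⟩ : Fin m)) (by simp)]
  congr 1
  ext j
  simp only [Finset.mem_filter, Finset.mem_univ, true_and, Finset.mem_insert]
  constructor
  · rintro ⟨h1, h2⟩
    rcases Nat.lt_succ_iff_lt_or_eq.1 h1 with h3 | h3
    · exact Or.inr ⟨h3, h2⟩
    · exact Or.inl (Fin.ext h3)
  · rintro (rfl | ⟨h1, h2⟩)
    · exact ⟨by simp, h, hd⟩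
    · exact ⟨by omega, h2⟩

theorem desBefore_succ_of_le {m k : ℕ} (w : Fin m → Fin k) (i : ℕ) (h : i + 1 < m)
    (hd : w ⟨i, by omega⟩ ≤ w ⟨i + 1, h⟩) : desBefore w (i + 1) = desBefore w i := by
  unfold desBefore
  congr 1
  ext j
  simp only [Finset.mem_filter, Finset.mem_univ, true_and]
  constructor
  · rintro ⟨h1, h2, h3⟩
    refine ⟨?_, h2, h3⟩
    rcases Nat.lt_succ_iff_lt_or_eq.1 h1 with h4 | h4
    · exact h4
    · obtain ⟨j, hj⟩ := j
      simp only at h4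
      subst h4
      exact absurd h3 (not_lt.2 hd)
  · rintro ⟨h1, h2⟩
    exact ⟨by omega, h2⟩

theorem le_of_desBefore_eq {m k : ℕ} (w : Fin m → Fin k) (i j : Fin m) (hij : i ≤ j)
    (h : desBefore w i = desBefore w j) : w i ≤ w j := by
  obtain ⟨j, hj⟩ := j
  have hij' : i.val ≤ j := hij
  clear hij
  induction j, hij' using Nat.le_induction with
  | base => exact le_rfl
  | succ j hj' ih =>
    have h1 := desBefore_mono w hj'
    have h2 := desBefore_mono w (show j ≤ j + 1 by omega)
    simp only at h h2
    refine (ih (by omega) (by simp only; omega)).trans ?_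
    by_contra! h3
    have := desBefore_succ_of_lt w j hj h3
    omega

/-- Stepwise growth at descents extends to arbitrary pairs of positions. -/
theorem add_desBefore_le {m k : ℕ} (w : Fin m → Fin k) (g : Fin m → ℕ)
    (hg : ∀ (i : ℕ) (h : i + 1 < m), g ⟨i, by omega⟩ ≤ g ⟨i + 1, h⟩ ∧
      (w ⟨i + 1, h⟩ < w ⟨i, by omega⟩ → g ⟨i, by omega⟩ < g ⟨i + 1, h⟩))
    (i j : Fin m) (hij : i ≤ j) : g i + desBefore w j ≤ g j + desBefore w i := by
  obtain ⟨j, hj⟩ := j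
  have hij' : i.val ≤ j := hij
  clear hij
  induction j, hij' using Nat.le_induction with
  | base => exact le_rfl
  | succ j hj' ih =>
    have := ih (by omega)
    have h1 := hg j hj
    simp only at this ⊢
    rcases lt_or_ge (w ⟨j + 1, hj⟩) (w ⟨j, by omega⟩) with h2 | h2
    · have := h1.2 h2
      have := desBefore_succ_of_lt w j hj h2
      omega
    · have := desBefore_succ_of_le w j hj h2
      omega

theorem RectSYT.desPerm_eq (σ : Equiv.Perm (Fin k)) (T : RectSYT k n) :
    T.desPerm σ = wordDes (canonWord (σ, T)) := by
  classical
  unfold RectSYT.desPerm RectSYT.bounce wordDes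
  rw [← Finset.card_biUnion]
  · congr 1
    ext i
    simp only [Finset.mem_biUnion, Finset.mem_filter, Finset.mem_univ, true_and]
    constructor
    · rintro ⟨p, h1, h, h2, h3⟩
      exact ⟨h, by simp only [canonWord]; rw [h2, h3]; exact h1⟩
    · rintro ⟨h, h1⟩
      exact ⟨(_, _), h1, h, rfl, rfl⟩
  · rintro p - q - hpq
    rw [Function.onFun, Finset.disjoint_left]
    intro i h1 h2
    simp only [Finset.mem_filter, Finset.mem_univ, true_and] at h1 h2
    obtain ⟨_, h1, h1'⟩ := h1
    obtain ⟨_, h2, h2'⟩ := h2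
    exact hpq (Prod.ext (h1.symm.trans h2) (h1'.symm.trans h2'))

theorem RectSYT.asc_eq (T : RectSYT k n) : T.asc = wordDes (canonWord (1, T)) := rfl

/-! ### Order-preserving maps with prescribed growth -/

/-- Maps on an ordered set that grow at least as fast as `D` and are bounded by `m` at `t`. -/
def growing {Q : Type*} [LE Q] (D : Q → ℕ) (t : Q) (m : ℕ) : Set (Q → ℕ) :=
  {f | (∀ p q, p ≤ q → f p + D q ≤ f q + D p) ∧ f t ≤ m}

section growing

variable {Q : Type*} [LE Q]

theorem growing_finite [Finite Q] {D : Q → ℕ} {t : Q} (ht : ∀ p, p ≤ t)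
    (hD : ∀ p q, p ≤ q → D p ≤ D q) (m : ℕ) : (growing D t m).Finite := by
  refine (Set.Finite.pi' fun _ : Q => Set.finite_Iic m).subset fun f hf p => ?_
  have := hf.1 p t (ht p)
  have := hD p t (ht p)
  have := hf.2
  show f p ≤ m
  omega

theorem growing_eq_empty {D : Q → ℕ} {b t : Q} (hb : ∀ p, b ≤ p) (hDb : D b = 0) {m : ℕ}
    (hm : m < D t) : growing D t m = ∅ := by
  rw [Set.eq_empty_iff_forall_notMem]
  intro f hf
  have := hf.1 b t (hb t)
  have := hf.2
  omega

/-- Subtracting `D` is a bijection: since `D` vanishes at the bottom element, growth forces `D ≤ f`,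
so truncated subtraction loses nothing. -/
theorem card_growing_add {D : Q → ℕ} {b t : Q} (hb : ∀ p, b ≤ p) (hDb : D b = 0) (m : ℕ) :
    Nat.card (growing D t (m + D t)) = Nat.card (growing (fun _ : Q => 0) t m) := by
  refine Nat.card_congr ⟨fun f => ⟨fun p => f.1 p - D p, ?_, ?_⟩,
    fun f => ⟨fun p => f.1 p + D p, ?_, ?_⟩, ?_, ?_⟩
  · intro p q hpq
    have := f.2.1 p q hpq
    have := f.2.1 b p (hb p)
    have := f.2.1 b q (hb q)
    simp only
    omega
  · have := f.2.2
    simp only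
    omega
  · intro p q hpq
    have := f.2.1 p q hpq
    simp only at this ⊢
    omega
  · have := f.2.2
    simp only
    omega
  · intro f
    ext p
    have := f.2.1 b p (hb p)
    simp only
    omega
  · intro f
    ext p
    simp

theorem card_growing_zero_pos [Finite Q] {t : Q} (ht : ∀ p, p ≤ t) (m : ℕ) :
    0 < Nat.card (growing (fun _ : Q => 0) t m) := by
  have := (growing_finite (D := fun _ : Q => 0) ht (by simp) m).to_subtype
  rw [Nat.card_pos_iff]
  exact ⟨⟨⟨fun _ => 0, by simp [growing]⟩⟩, this⟩

end growing

/-- If the distributions of `x` and `y` agree after convolution with a function that does not vanish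
at `0`, they agree. -/
theorem card_fiber_eq_of_sum_eq {τ : Type*} [Fintype τ] (x y : τ → ℕ) (M : ℕ → ℕ) (hM : M 0 ≠ 0)
    (h : ∀ m, ∑ T, (if x T ≤ m then M (m - x T) else 0) =
      ∑ T, (if y T ≤ m then M (m - y T) else 0)) (d : ℕ) :
    (Finset.univ.filter fun T => x T = d).card = (Finset.univ.filter fun T => y T = d).card := by
  have key : ∀ (z : τ → ℕ) (m : ℕ), ∑ T, (if z T ≤ m then M (m - z T) else 0) =
      ∑ d ∈ Finset.range (m + 1), (Finset.univ.filter fun T => z T = d).card * M (m - d) := by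
    intro z m
    simp_rw [Finset.card_filter, Finset.sum_mul]
    rw [Finset.sum_comm]
    refine Finset.sum_congr rfl fun T _ => ?_
    simp
  -- The convolution at `d` involves the fibre over `d` only through the factor `M 0`; the other
  -- terms agree by induction.
  induction d using Nat.strong_induction_on with
  | _ d ih =>
    have h1 := h d
    rw [key, key, Finset.sum_range_succ, Finset.sum_range_succ,
      Finset.sum_congr rfl fun e he => by rw [ih e (Finset.mem_range.1 he)]] at h1
    simp only [Nat.sub_self] at h1
    exact Nat.eq_of_mul_eq_mul_right (Nat.pos_of_ne_zero hM) (Nat.add_left_cancel h1)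

theorem exists_perm_of_card_fiber_eq {τ : Type*} [Fintype τ] (x y : τ → ℕ)
    (h : ∀ d, (Finset.univ.filter fun T => x T = d).card =
      (Finset.univ.filter fun T => y T = d).card) :
    ∃ φ : Equiv.Perm τ, ∀ T, y (φ T) = x T := by
  have e : ∀ d, Nonempty ({T // x T = d} ≃ {T // y T = d}) := fun d => by
    rw [← Fintype.card_eq, Fintype.card_subtype, Fintype.card_subtype, h d]
  have e := fun d => (e d).some
  refine ⟨(Equiv.sigmaFiberEquiv x).symm.trans
    ((Equiv.sigmaCongrRight fun d => (e d)).trans (Equiv.sigmaFiberEquiv y)), fun T => ?_⟩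
  exact ((e (x T)) ⟨T, rfl⟩).2

/-! ### The fundamental lemma on `(P, ω)`-partitions for rectangles -/

theorem mul_add_lt_iff {N A B x y : ℕ} (hx : x < N) (hy : y < N) :
    A * N + x < B * N + y ↔ A < B ∨ A = B ∧ x < y := by
  rcases lt_trichotomy A B with h | h | h
  · have : (A + 1) * N ≤ B * N := Nat.mul_le_mul_right _ h
    rw [add_mul] at this
    simp only [h, true_or, iff_true]
    omega
  · subst h
    simp
  · have : (B + 1) * N ≤ A * N := Nat.mul_le_mul_right _ h
    rw [add_mul] at this
    constructor
    · intro; omega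
    · rintro (h1 | h1) <;> omega

/-- A mixed-radix numeral with digits `u < k` and `c < n` turns the lexicographic order on triples
into the order of ℕ. -/
theorem key_lt_iff_lex (k n : ℕ) (a b : ℕ) (u v : Fin k) (c d : Fin n) :
    (a * k + u.val) * n + c.val < (b * k + v.val) * n + d.val ↔
      a < b ∨ a = b ∧ (u < v ∨ u = v ∧ c < d) := by
  have aux2 : ∀ (m A B x y : ℕ), x < m → y < m → (A * m + x = B * m + y ↔ A = B ∧ x = y) := by
    intro m A B x y hx hy
    have h1 := mul_add_lt_iff (A := A) (B := B) hx hy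
    have h2 := mul_add_lt_iff (A := B) (B := A) hy hx
    omega
  rw [mul_add_lt_iff c.2 d.2, mul_add_lt_iff u.2 v.2, aux2 k _ _ _ _ u.2 v.2]
  simp only [Fin.lt_def, Fin.ext_iff]
  omega

/-- Where `g` stays constant the descent count does too, so the word has no descent in between. -/
theorem growing_lex (w : Fin n → Fin k) (g : Fin n → ℕ)
    (hg : ∀ p q, p ≤ q → g p + desBefore w q ≤ g q + desBefore w p) (i j : Fin n) (hij : i ≤ j) :
    g i < g j ∨ g i = g j ∧ w i ≤ w j := by
  have h1 := hg i j hij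
  have h2 := desBefore_mono w (show i.val ≤ j.val from hij)
  by_cases h : desBefore w i = desBefore w j
  · have := le_of_desBefore_eq w i j hij h
    rcases lt_or_eq_of_le (show g i ≤ g j by omega) with h3 | h3
    · exact Or.inl h3
    · exact Or.inr ⟨h3, this⟩
  · left; omega

/-- The bijection sends (T, g) to the composite of g with the filling T. Its inverse sorts the cells
by (f, σ of the row, column). As ties in f are broken by the letter, f can stay constant along the
word only where there is no descent. -/
theorem card_growing_cells (hk : 1 ≤ k) (hn : 1 ≤ n) (hN : 1 ≤ k * n) (σ : Equiv.Perm (Fin k))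
    (m : ℕ) :
    Nat.card (growing (fun p : Fin k × Fin n => desBefore σ p.1)
      (⟨k - 1, by omega⟩, ⟨n - 1, by omega⟩) m) =
    ∑ T : RectSYT k n, Nat.card (growing (fun i : Fin (k * n) =>
      desBefore (canonWord (σ, T)) i) ⟨k * n - 1, by omega⟩ m) := by
  have hfin : ∀ T : RectSYT k n, Finite (growing (fun i : Fin (k * n) =>
      desBefore (canonWord (σ, T)) i) ⟨k * n - 1, by omega⟩ m) := fun T =>
    (growing_finite (Q := Fin (k * n)) (fun p => by rw [Fin.le_def]; simp only; omega)
      (fun p q hpq => desBefore_mono _ hpq) m).to_subtype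
  rw [← Nat.card_sigma]
  symm
  have hlast : ∀ T : RectSYT k n,
      T.entry (⟨k - 1, by omega⟩, ⟨n - 1, by omega⟩) = ⟨k * n - 1, by omega⟩ := by
    intro T
    apply le_antisymm
    · rw [Fin.le_def]
      simp only
      omega
    · obtain ⟨p, hp⟩ := T.entry.surjective ⟨k * n - 1, by omega⟩
      rw [← hp]
      apply T.le_of_le
      constructor
      · rw [Fin.le_def]; simp only; omega
      · rw [Fin.le_def]; simp only; omega
  -- The order of T is the order of the composite key, which depends only on σ and the map on the
  -- cells; this gives injectivity.
  have key_of : ∀ (T : RectSYT k n) (g : Fin (k * n) → ℕ),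
      (∀ p q, p ≤ q → g p + desBefore (canonWord (σ, T)) q ≤ g q + desBefore (canonWord (σ, T)) p) →
      ∀ p q, T.entry p < T.entry q →
      (g (T.entry p) * k + (σ p.1).val) * n + p.2.val <
        (g (T.entry q) * k + (σ q.1).val) * n + q.2.val := by
    intro T g hg p q hpq
    rw [key_lt_iff_lex]
    rcases growing_lex _ _ hg _ _ hpq.le with h | ⟨h1, h2⟩
    · exact Or.inl h
    · refine Or.inr ⟨h1, ?_⟩
      simp only [canonWord, RectSYT.rowOf, Equiv.symm_apply_apply] at h2
      rcases lt_or_eq_of_le h2 with h2 | h2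
      · exact Or.inl h2
      · refine Or.inr ⟨h2, ?_⟩
        have h3 := σ.injective h2
        obtain ⟨p1, p2⟩ := p
        obtain ⟨q1, q2⟩ := q
        simp only at h3
        subst h3
        exact (T.row_lt_iff _ _ _).1 hpq
  refine Nat.card_congr (Equiv.ofBijective
    (fun x => ⟨fun p => x.2.1 (x.1.entry p), ?_, ?_⟩) ⟨?_, ?_⟩)
  · obtain ⟨T, g, hg, hgm⟩ := x
    rintro ⟨r, c⟩ ⟨r', c'⟩ ⟨hr, hc⟩
    simp only at hr hc ⊢
    have h1 : g (T.entry (r, c)) ≤ g (T.entry (r, c')) := by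
      have h1 := T.le_of_le (p := (r, c)) (q := (r, c')) ⟨le_rfl, hc⟩
      have : g (T.entry (r, c)) + desBefore (canonWord (σ, T)) (T.entry (r, c')) ≤
          g (T.entry (r, c')) + desBefore (canonWord (σ, T)) (T.entry (r, c)) := hg _ _ h1
      have := desBefore_mono (canonWord (σ, T)) (Fin.le_def.1 h1)
      omega
    -- The letters down a column are the values of σ, so at a descent of σ the lexicographic
    -- alternative forces `g` to grow.
    have := add_desBefore_le σ (fun s => g (T.entry (s, c'))) (fun i h => by
      have h2 : T.entry (⟨i, by omega⟩, c') < T.entry (⟨i + 1, h⟩, c') :=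
        T.col_lt _ _ _ (by simp)
      have := growing_lex _ g hg _ _ h2.le
      simp only [canonWord, RectSYT.rowOf, Equiv.symm_apply_apply] at this
      constructor
      · rcases this with h | h <;> omega
      · intro h3
        rcases this with h | h
        · exact h
        · exact absurd h.2 (not_le.2 h3)) r r' hr
    omega
  · obtain ⟨T, g, hg, hgm⟩ := x
    simp only [hlast]
    exact hgm
  · rintro ⟨T, g, hg, hgm⟩ ⟨T', g', hg', hgm'⟩ h
    have h : ∀ p, g (T.entry p) = g' (T'.entry p) := fun p =>
      congrFun (congrArg Subtype.val h) p
    have hT : T = T' := by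
      refine RectSYT.ext_of_lt fun p q hpq => ?_
      by_contra! hqp
      have h1 := key_of T g hg p q hpq
      rcases lt_or_eq_of_le hqp with h2 | h2
      · have := key_of T' g' hg' q p h2
        rw [h p, h q] at h1
        omega
      · rw [T'.entry.injective h2] at hpq
        exact absurd hpq (lt_irrefl _)
    subst hT
    have : g = g' := by
      ext i
      have := h (T.entry.symm i)
      simpa using this
    subst this
    rfl
  · rintro ⟨f, hf, hfm⟩
    let key : Fin k × Fin n → ℕ := fun p => (f p * k + (σ p.1).val) * n + p.2.val
    have hkey : ∀ p q, key p < key q ↔ f p < f q ∨ f p = f q ∧ (σ p.1 < σ q.1 ∨ σ p.1 = σ q.1 ∧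
      p.2 < q.2) := fun p q => key_lt_iff_lex _ _ _ _ _ _ _ _
    obtain ⟨T, hT⟩ := RectSYT.exists_of_key key
      (by
        intro p q hpq
        have h1 := hkey p q
        have h2 := hkey q p
        rw [hpq] at h1
        rw [hpq] at h2
        simp only [lt_self_iff_false, false_iff, not_or, not_and, not_lt] at h1 h2
        have h3 : f p = f q := by omega
        have h4 : σ p.1 = σ q.1 := le_antisymm (h2.2 h3.symm).1 (h1.2 h3).1
        exact Prod.ext (σ.injective h4)
          (le_antisymm ((h2.2 h3.symm).2 h4.symm) ((h1.2 h3).2 h4)))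
      (by
        intro r c c' hc
        rw [hkey]
        have := hf (r, c) (r, c') ⟨le_rfl, hc.le⟩
        simp only at this
        rcases lt_or_eq_of_le (show f (r, c) ≤ f (r, c') by omega) with h | h
        · exact Or.inl h
        · exact Or.inr ⟨h, Or.inr ⟨rfl, hc⟩⟩)
      (by
        intro r r' c hr
        rw [hkey]
        have := hf (r, c) (r', c) ⟨hr.le, le_rfl⟩
        have h2 := desBefore_mono σ (show r.val ≤ r'.val from hr.le)
        simp only at this
        -- Without a descent of σ between the rows a tie in `f` is broken by σ r < σ r'; with a
        -- descent `f` itself grows.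
        by_cases h : desBefore σ r = desBefore σ r'
        · have h3 := le_of_desBefore_eq σ r r' hr.le h
          have h4 : σ r < σ r' := lt_of_le_of_ne h3 fun h => hr.ne (σ.injective h)
          rcases lt_or_eq_of_le (show f (r, c) ≤ f (r', c) by omega) with h | h
          · exact Or.inl h
          · exact Or.inr ⟨h, Or.inl h4⟩
        · left; omega)
    refine ⟨⟨T, ⟨fun i => f (T.entry.symm i), ?_, ?_⟩⟩, ?_⟩
    · apply add_desBefore_le
      intro i h
      have := (hT (T.entry.symm ⟨i, by omega⟩) (T.entry.symm ⟨i + 1, h⟩)).1 (by simp)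
      rw [hkey] at this
      simp only [canonWord, RectSYT.rowOf]
      constructor
      · rcases this with h | h <;> omega
      · intro h1
        rcases this with h | ⟨-, h | h⟩
        · exact h
        · exact absurd h1 h.not_gt
        · rw [h.1] at h1
          exact absurd h1 (lt_irrefl _)
    · simp only [← hlast T, Equiv.symm_apply_apply]
      exact hfm
    · ext p
      simp

theorem exists_isDescentFamily (hk : 1 ≤ k) (hn : 1 ≤ n) :
    ∃ φ : Equiv.Perm (Fin k) → Equiv.Perm (RectSYT k n), IsDescentFamily φ := by
  have hN : 1 ≤ k * n := Nat.mul_pos hk hn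
  suffices ∀ σ : Equiv.Perm (Fin k), ∃ φ : Equiv.Perm (RectSYT k n),
      ∀ T : RectSYT k n, T.desPerm σ = (φ T).asc + wordDes σ by
    choose φ hφ using this
    exact ⟨φ, hφ⟩
  intro σ
  have htop : ∀ p : Fin (k * n), p ≤ ⟨k * n - 1, by omega⟩ := fun p => by
    rw [Fin.le_def]; simp only; omega
  let M : ℕ → ℕ := fun m =>
    Nat.card (growing (fun _ : Fin (k * n) => 0) ⟨k * n - 1, by omega⟩ m)
  have hT : ∀ (σ : Equiv.Perm (Fin k)) (T : RectSYT k n) (m : ℕ),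
      Nat.card (growing (fun i : Fin (k * n) =>
        desBefore (canonWord (σ, T)) i) ⟨k * n - 1, by omega⟩ m) =
      if T.desPerm σ ≤ m then M (m - T.desPerm σ) else 0 := by
    intro σ T m
    have hb : ∀ p : Fin (k * n), (⟨0, by omega⟩ : Fin (k * n)) ≤ p := fun p => by
      rw [Fin.le_def]; simp
    have hD := desBefore_last (canonWord (σ, T))
    rw [← T.desPerm_eq] at hD
    split_ifs with h
    · have := card_growing_add (D := fun i : Fin (k * n) => desBefore (canonWord (σ, T)) i)
        (t := ⟨k * n - 1, by omega⟩) hb (desBefore_zero _) (m - T.desPerm σ)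
      simp only [hD] at this
      rw [Nat.sub_add_cancel h] at this
      exact this
    · rw [growing_eq_empty hb (desBefore_zero _)]
      · simp
      · simp only [hD]; omega
  -- The count on the cells depends on σ only through a shift by des(σ).
  have hS : ∀ (σ : Equiv.Perm (Fin k)) (m : ℕ),
      ∑ T : RectSYT k n, (if T.desPerm σ ≤ m then M (m - T.desPerm σ) else 0) =
      if wordDes σ ≤ m then Nat.card (growing (fun _ : Fin k × Fin n => 0)
        (⟨k - 1, by omega⟩, ⟨n - 1, by omega⟩) (m - wordDes σ)) else 0 := by
    intro σ m
    simp_rw [← hT]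
    rw [← card_growing_cells hk hn hN]
    have hb : ∀ p : Fin k × Fin n, ((⟨0, by omega⟩, ⟨0, by omega⟩) : Fin k × Fin n) ≤ p := fun p =>
      ⟨by rw [Fin.le_def]; simp, by rw [Fin.le_def]; simp⟩
    have hD := desBefore_last σ
    split_ifs with h
    · have := card_growing_add (D := fun p : Fin k × Fin n => desBefore σ p.1)
        (t := (⟨k - 1, by omega⟩, ⟨n - 1, by omega⟩)) hb (desBefore_zero _) (m - wordDes σ)
      simp only [hD] at this
      rw [Nat.sub_add_cancel h] at this
      exact this
    · rw [growing_eq_empty hb (desBefore_zero _)]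
      · simp
      · simp only [hD]; omega
  -- For m = des_σ(T) < des(σ) the count on the cells would vanish, while T alone contributes `M 0 >
  -- 0`.
  have hle : ∀ T : RectSYT k n, wordDes σ ≤ T.desPerm σ := by
    intro T
    by_contra! h
    have h1 := hS σ (T.desPerm σ)
    rw [if_neg (by omega), Finset.sum_eq_zero_iff] at h1
    have := h1 T (Finset.mem_univ _)
    rw [if_pos le_rfl] at this
    exact (card_growing_zero_pos htop _).ne' this
  have h1 : wordDes (1 : Equiv.Perm (Fin k)) = 0 := by
    unfold wordDes
    rw [Finset.card_eq_zero, Finset.filter_eq_empty_iff]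
    rintro i - ⟨h, h1⟩
    simp [Fin.lt_def] at h1
  have hfib := card_fiber_eq_of_sum_eq (fun T : RectSYT k n => T.desPerm σ - wordDes σ)
    (fun T => T.desPerm 1) M (card_growing_zero_pos htop _).ne' (fun m => by
      rw [hS 1 m, h1, if_pos (Nat.zero_le _)]
      have h2 := hS σ (m + wordDes σ)
      rw [if_pos (by omega), Nat.add_sub_cancel] at h2
      rw [Nat.sub_zero, ← h2]
      refine Finset.sum_congr rfl fun T _ => ?_
      have := hle T
      have h3 : T.desPerm σ - wordDes σ ≤ m ↔ T.desPerm σ ≤ m + wordDes σ := by omega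
      simp only [h3]
      congr 2
      omega)
  obtain ⟨φ, hφ⟩ := exists_perm_of_card_fiber_eq _ _ hfib
  refine ⟨φ, fun T => ?_⟩
  have h2 := hφ T
  have := hle T
  rw [RectSYT.desPerm_eq, ← RectSYT.asc_eq] at h2
  omega

/-! ### Canon permutations and pairs -/

/-- The number of earlier occurrences of the letter at position `p`. -/
def copyNo {m k : ℕ} (w : Fin m → Fin k) (p : Fin m) : ℕ :=
  (Finset.univ.filter fun q : Fin m => q < p ∧ w q = w p).card

theorem copyNo_lt {m k : ℕ} {w : Fin m → Fin k} {p q : Fin m} (hw : w p = w q) (h : p < q) :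
    copyNo w p < copyNo w q := by
  refine Finset.card_lt_card ⟨fun x => ?_, fun hs => ?_⟩
  · simp only [Finset.mem_filter, Finset.mem_univ, true_and]
    exact fun hx => ⟨hx.1.trans h, hx.2.trans hw⟩
  · have := @hs p (by simp [h, hw])
    simp at this

theorem copySubword_eq {m k : ℕ} (w : Fin m → Fin k) (j : ℕ) :
    copySubword w j = ((List.finRange m).filter fun p => decide (copyNo w p = j)).map w := rfl

/-- The earlier occurrences of the letter of the cell (r, c) are the cells of row r to its left. -/
theorem RectSYT.copyNo_canonWord (σ : Equiv.Perm (Fin k)) (T : RectSYT k n) (p : Fin k × Fin n) :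
    copyNo (canonWord (σ, T)) (T.entry p) = p.2 := by
  obtain ⟨r, c⟩ := p
  have : (Finset.univ.filter fun q : Fin (k * n) => q < T.entry (r, c) ∧
      canonWord (σ, T) q = canonWord (σ, T) (T.entry (r, c))) =
      (Finset.Iio c).image fun c' => T.entry (r, c') := by
    ext q
    obtain ⟨⟨r', c'⟩, rfl⟩ := T.entry.surjective q
    simp only [Finset.mem_filter, Finset.mem_univ, true_and, canonWord, RectSYT.rowOf,
      Equiv.symm_apply_apply, EmbeddingLike.apply_eq_iff_eq, Finset.mem_image,
      Finset.mem_Iio, Prod.mk.injEq]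
    constructor
    · rintro ⟨h, rfl⟩
      exact ⟨c', (T.row_lt_iff _ _ _).1 h, rfl, rfl⟩
    · rintro ⟨x, h, rfl, rfl⟩
      exact ⟨(T.row_lt_iff _ _ _).2 h, rfl⟩
  rw [copyNo, this, Finset.card_image_of_injective _ fun a b h => by simpa using T.entry.injective h]
  simp

/-- The `j`-th copies sit in column `j`, whose entries increase from top to bottom. -/
theorem RectSYT.copySubword_canonWord (σ : Equiv.Perm (Fin k)) (T : RectSYT k n) (j : Fin n) :
    copySubword (canonWord (σ, T)) j = (List.finRange k).map σ := by
  have : ((List.finRange (k * n)).filter fun p => decide (copyNo (canonWord (σ, T)) p = j)) =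
      (List.finRange k).map fun r => T.entry (r, j) := by
    apply List.Pairwise.eq_of_mem_iff (r := fun a b : Fin (k * n) => a < b)
    · exact (List.pairwise_lt_finRange _).filter _
    · rw [List.pairwise_map]
      exact (List.pairwise_lt_finRange k).imp fun h => T.col_lt _ _ _ h
    · intro p
      obtain ⟨⟨r, c⟩, rfl⟩ := T.entry.surjective p
      simp only [List.mem_filter, List.mem_finRange, true_and, decide_eq_true_eq,
        T.copyNo_canonWord, List.mem_map, EmbeddingLike.apply_eq_iff_eq, Prod.mk.injEq]
      constructor
      · intro h
        exact ⟨r, rfl, (Fin.ext h).symm⟩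
      · rintro ⟨_, rfl, rfl⟩
        rfl
  rw [copySubword_eq, this, List.map_map]
  simp [Function.comp_def, canonWord, RectSYT.rowOf]

theorem canonWord_injective (hn : 1 ≤ n) : Function.Injective (canonWord (k := k) (n := n)) := by
  rintro ⟨σ, T⟩ ⟨σ', T'⟩ h
  have h1 := T.copySubword_canonWord σ ⟨0, hn⟩
  rw [h, T'.copySubword_canonWord, List.map_inj_left] at h1
  have hσ : σ = σ' := Equiv.ext fun r => (h1 r (List.mem_finRange r)).symm
  subst hσ
  congr 1
  ext p : 2
  have h2 := T.copyNo_canonWord σ p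
  rw [h] at h2
  obtain ⟨q, hq⟩ := T'.entry.surjective (T.entry p)
  rw [← hq, T'.copyNo_canonWord] at h2
  have h3 := congrFun h (T.entry p)
  nth_rw 2 [← hq] at h3
  simp only [canonWord, RectSYT.rowOf, Equiv.symm_apply_apply, EmbeddingLike.apply_eq_iff_eq] at h3
  rw [← hq, Prod.ext h3 (Fin.ext h2.symm)]

theorem canonWord_mem (σ : Equiv.Perm (Fin k)) (T : RectSYT k n) :
    canonWord (σ, T) ∈ canonPerms k n := by
  refine ⟨fun a => ?_, fun i j hi hj => ?_⟩
  · have : (Finset.univ.filter fun p => canonWord (σ, T) p = a) =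
        Finset.univ.image fun c => T.entry (σ.symm a, c) := by
      ext q
      obtain ⟨⟨r, c⟩, rfl⟩ := T.entry.surjective q
      rw [Finset.mem_filter]
      simp only [Finset.mem_univ, true_and, canonWord, RectSYT.rowOf, Equiv.symm_apply_apply,
        Finset.mem_image, EmbeddingLike.apply_eq_iff_eq, Prod.mk.injEq, Equiv.symm_apply_eq,
        eq_comm (a := a)]
      simp
    rw [this, Finset.card_image_of_injective _ fun a b h => by simpa using T.entry.injective h]
    simp
  · exact (T.copySubword_canonWord σ ⟨i, hi⟩).trans (T.copySubword_canonWord σ ⟨j, hj⟩).symm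

/-- Positions correspond to pairs (letter, copy number). The common subword contains every letter
once and thereby defines σ. That it is common to all copies says that the columns increase; rows
increase because copy numbers do. -/
theorem exists_canonWord_eq (hn : 1 ≤ n) {w : Fin (k * n) → Fin k} (hw : w ∈ canonPerms k n) :
    ∃ p, canonWord p = w := by
  obtain ⟨hw1, hw2⟩ := hw
  have hlt : ∀ p, copyNo w p < n := fun p => by
    refine lt_of_lt_of_eq ?_ (hw1 (w p))
    refine Finset.card_lt_card ⟨fun x => ?_, fun hs => ?_⟩
    · simp only [Finset.mem_filter, Finset.mem_univ, true_and]
      exact fun hx => hx.2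
    · have := @hs p (by simp)
      simp at this
  let e0 : Fin (k * n) → Fin k × Fin n := fun p => (w p, ⟨copyNo w p, hlt p⟩)
  have hinj : Function.Injective e0 := by
    intro p q h
    simp only [e0, Prod.mk.injEq, Fin.mk.injEq] at h
    rcases lt_trichotomy p q with h1 | h1 | h1
    · have := copyNo_lt h.1 h1
      omega
    · exact h1
    · have := copyNo_lt h.1.symm h1
      omega
  let e := Equiv.ofBijective e0 ((Fintype.bijective_iff_injective_and_card e0).2 ⟨hinj, by simp⟩)
  have he1 : ∀ x, w (e.symm x) = x.1 := fun x => congrArg Prod.fst (e.apply_symm_apply x)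
  have he2 : ∀ x, copyNo w (e.symm x) = x.2 := fun x =>
    congrArg (fun y => y.2.val) (e.apply_symm_apply x)
  set L := copySubword w 0 with hL
  have hsorted : ∀ j : Fin n, L.Pairwise fun a b => e.symm (a, j) < e.symm (b, j) := by
    intro j
    rw [hL, hw2 0 j hn j.2, copySubword_eq, List.pairwise_map]
    refine List.Pairwise.imp_of_mem ?_ ((List.pairwise_lt_finRange (k * n)).filter _)
    intro p q hp hq hpq
    simp only [List.mem_filter, List.mem_finRange, true_and, decide_eq_true_eq] at hp hq
    have : ∀ p, copyNo w p = j → e.symm (w p, j) = p := fun p hp => by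
      rw [Equiv.symm_apply_eq]
      exact Prod.ext rfl (Fin.ext hp.symm)
    rwa [this p hp, this q hq]
  have hnodup : L.Nodup := (hsorted ⟨0, hn⟩).imp fun h h' => by
    rw [h'] at h
    exact lt_irrefl _ h
  have hall : ∀ a, a ∈ L := by
    intro a
    rw [hL, copySubword_eq, List.mem_map]
    refine ⟨e.symm (a, ⟨0, hn⟩), ?_, he1 _⟩
    simp [he2]
  let τ := hnodup.getEquivOfForallMemList L hall
  have hlen : k = L.length := by simpa using (Fintype.card_congr τ).symm
  let σ : Equiv.Perm (Fin k) := (finCongr hlen).trans τ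
  have hσ : ∀ (r r' : Fin k) (c : Fin n), r < r' → e.symm (σ r, c) < e.symm (σ r', c) := by
    intro r r' c h
    have := List.pairwise_iff_get.1 (hsorted c) (finCongr hlen r) (finCongr hlen r') h
    exact this
  refine ⟨(σ, ⟨(Equiv.prodCongr σ (Equiv.refl _)).trans e.symm, ?_, fun r r' c h => hσ r r' c h⟩),
    ?_⟩
  · intro r c c' h
    by_contra! h1
    simp only [Equiv.trans_apply, Equiv.prodCongr_apply, Prod.map_apply, Equiv.refl_apply] at h1
    rcases lt_or_eq_of_le h1 with h2 | h2
    · have := copyNo_lt (w := w) (by rw [he1, he1]) h2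
      rw [he2, he2] at this
      exact absurd h this.not_gt
    · have := e.symm.injective h2
      simp only [Prod.mk.injEq, true_and] at this
      exact h.ne this.symm
  · ext i
    simp [canonWord, RectSYT.rowOf, e, e0]

theorem canonWord_bijOn (hn : 1 ≤ n) :
    Set.BijOn (canonWord (k := k) (n := n)) Set.univ (canonPerms k n) :=
  ⟨fun p _ => canonWord_mem p.1 p.2, (canonWord_injective hn).injOn, fun _ hw => by
    simpa using exists_canonWord_eq hn hw⟩

/-! ### Complements -/

theorem permCompl_permCompl (σ : Equiv.Perm (Fin k)) : permCompl (permCompl σ) = σ := by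
  ext i
  simp [permCompl]

/-- At each of the k - 1 adjacent pairs the two values differ, so exactly one of σ and σ^c descends.
-/
theorem wordDes_add_wordDes_permCompl (σ : Equiv.Perm (Fin k)) :
    wordDes σ + wordDes (permCompl σ) = k - 1 := by
  unfold wordDes
  rw [← Finset.card_union_of_disjoint]
  · have : (Finset.univ.filter fun i : Fin k => i.val + 1 < k).card = k - 1 := by
      rw [← Finset.card_range (k - 1)]
      refine Finset.card_bij (fun i _ => i.val) ?_ (fun _ _ _ _ h => Fin.ext h) ?_
      · intro i hi
        simp only [Finset.mem_filter, Finset.mem_univ, true_and] at hi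
        rw [Finset.mem_range]
        omega
      · intro i hi
        rw [Finset.mem_range] at hi
        exact ⟨⟨i, by omega⟩, by simp only [Finset.mem_filter, Finset.mem_univ, true_and]; omega, rfl⟩
    rw [← this]
    congr 1
    ext i
    simp only [Finset.mem_union, Finset.mem_filter, Finset.mem_univ, true_and, permCompl,
      Equiv.trans_apply, Fin.revPerm_apply, Fin.rev_lt_rev]
    constructor
    · rintro (⟨h, -⟩ | ⟨h, -⟩) <;> exact h
    · intro h
      have hne : σ ⟨i.val + 1, h⟩ ≠ σ i := fun h' => by
        have := congrArg Fin.val (σ.injective h')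
        simp at this
      rcases lt_or_gt_of_ne hne with h1 | h1
      · exact Or.inl ⟨h, h1⟩
      · exact Or.inr ⟨h, h1⟩
  · rw [Finset.disjoint_left]
    intro i
    simp only [Finset.mem_filter, Finset.mem_univ, true_and, permCompl,
      Equiv.trans_apply, Fin.revPerm_apply, Fin.rev_lt_rev]
    rintro ⟨h, h1⟩ ⟨_, h2⟩
    exact h1.not_gt h2

/-! ### The time evolution of a tableau -/

/-- The row of the entry `i`, and the bottom row for `i` out of range. -/
def RectSYT.rowAt (T : RectSYT k n) (i : ℕ) : ℕ :=
  if h : i < k * n then (T.rowOf ⟨i, h⟩).val else k - 1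

/-- The number of entries less than `t` in row `s`. -/
def RectSYT.count (T : RectSYT k n) (t : ℕ) (s : Fin k) : ℕ :=
  (Finset.univ.filter fun c : Fin n => (T.entry (s, c)).val < t).card

theorem RectSYT.rowAt_entry (T : RectSYT k n) (p : Fin k × Fin n) :
    T.rowAt (T.entry p) = p.1 := by
  simp [RectSYT.rowAt, RectSYT.rowOf]

theorem RectSYT.exists_entry (T : RectSYT k n) {i : ℕ} (h : i < k * n) :
    ∃ p, (T.entry p).val = i := by
  obtain ⟨p, hp⟩ := T.entry.surjective ⟨i, h⟩
  exact ⟨p, congrArg Fin.val hp⟩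

theorem RectSYT.count_entry (T : RectSYT k n) (s : Fin k) (c : Fin n) :
    T.count (T.entry (s, c)) s = c := by
  have : (Finset.univ.filter fun c' : Fin n => (T.entry (s, c')).val < (T.entry (s, c)).val) =
      Finset.Iio c := by
    ext c'
    simpa using T.row_lt_iff s c' c
  rw [RectSYT.count, this]
  simp

theorem RectSYT.count_zero (T : RectSYT k n) (s : Fin k) : T.count 0 s = 0 := by
  simp [RectSYT.count]

theorem RectSYT.count_top (T : RectSYT k n) (s : Fin k) : T.count (k * n) s = n := by
  simp [RectSYT.count]

theorem RectSYT.count_mono (T : RectSYT k n) (s : Fin k) {t t' : ℕ} (h : t ≤ t') :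
    T.count t s ≤ T.count t' s := by
  refine Finset.card_le_card fun c => ?_
  simp only [Finset.mem_filter, Finset.mem_univ, true_and]
  omega

theorem RectSYT.count_succ_of_eq (T : RectSYT k n) (s : Fin k) {t : ℕ} (ht : t < k * n)
    (h : T.rowAt t = s) : T.count (t + 1) s = T.count t s + 1 := by
  obtain ⟨⟨r, c⟩, rfl⟩ := T.exists_entry ht
  rw [T.rowAt_entry] at h
  obtain rfl : r = s := Fin.ext h
  unfold RectSYT.count
  rw [← Finset.card_insert_of_notMem (a := c) (by simp)]
  congr 1
  ext c'
  simp only [Finset.mem_filter, Finset.mem_univ, true_and, Finset.mem_insert, Nat.lt_succ_iff_lt_or_eq]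
  rw [or_comm]
  refine or_congr ⟨fun h => ?_, fun h => by rw [h]⟩ Iff.rfl
  have := T.entry.injective (Fin.ext h)
  simpa using this

theorem RectSYT.count_succ_of_ne (T : RectSYT k n) (s : Fin k) {t : ℕ}
    (h : T.rowAt t ≠ s) : T.count (t + 1) s = T.count t s := by
  unfold RectSYT.count
  congr 1
  ext c'
  simp only [Finset.mem_filter, Finset.mem_univ, true_and, Nat.lt_succ_iff_lt_or_eq, or_iff_left_iff_imp]
  intro h1
  rw [← h1, T.rowAt_entry] at h
  exact absurd rfl h

theorem RectSYT.filled_eq (T : RectSYT k n) (i : Fin (k * n)) (s : Fin k) :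
    T.filled i s = T.count (i + 1) s := by
  unfold RectSYT.filled RectSYT.count
  refine congrArg Finset.card (Finset.filter_congr fun c _ => ?_)
  rw [Fin.le_def, Nat.lt_succ_iff]

theorem RectSYT.rowAt_zero (T : RectSYT k n) (h : 0 < k * n) : T.rowAt 0 = 0 := by
  obtain ⟨⟨r, c⟩, hp⟩ := T.exists_entry h
  rw [← hp, T.rowAt_entry]
  by_contra h1
  have := T.col_lt ⟨0, by omega⟩ r c (by rw [Fin.lt_def]; simp only at h1 ⊢; omega)
  rw [Fin.lt_def] at this
  omega

theorem RectSYT.rowAt_lt (T : RectSYT k n) (hk : 1 ≤ k) (i : ℕ) : T.rowAt i < k := by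
  unfold RectSYT.rowAt
  split_ifs
  · exact Fin.is_lt _
  · omega

theorem RectSYT.rowAt_top (T : RectSYT k n) : T.rowAt (k * n) = k - 1 := by
  simp [RectSYT.rowAt]

theorem RectSYT.ext_of_rowAt {T T' : RectSYT k n} (h : ∀ i < k * n, T.rowAt i = T'.rowAt i) :
    T = T' := by
  have hc : ∀ t ≤ k * n, ∀ s, T.count t s = T'.count t s := by
    intro t
    induction t with
    | zero => simp [RectSYT.count_zero]
    | succ t ih =>
      intro ht s
      by_cases h1 : T.rowAt t = s
      · rw [T.count_succ_of_eq s (by omega) h1,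
          T'.count_succ_of_eq s (by omega) (by rw [← h t (by omega), h1]), ih (by omega)]
      · rw [T.count_succ_of_ne s h1,
          T'.count_succ_of_ne s (by rwa [← h t (by omega)]), ih (by omega)]
  ext p : 2
  obtain ⟨q, hq⟩ := T'.entry.surjective (T.entry p)
  have h1 := h (T.entry p) (Fin.is_lt _)
  rw [T.rowAt_entry, ← hq, T'.rowAt_entry] at h1
  obtain ⟨r, c⟩ := p
  obtain ⟨r', c'⟩ := q
  obtain rfl : r = r' := Fin.ext h1
  have h2 := hc (T.entry (r, c)) (Fin.is_lt _).le r
  rw [T.count_entry, ← hq, T'.count_entry] at h2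
  obtain rfl : c = c' := Fin.ext h2
  exact hq.symm

/-! ### Arrow encodings, step by step -/

/-- The arrow in row `s` produced by a step from row `a` to row `b`. -/
def stepArrow (s a b : ℕ) : Option Arrow :=
  if a ≤ s ∧ s < b then some Arrow.down
  else if b < s ∧ s ≤ a then some Arrow.up
  else none

/-- The arrow that step `i` appends to the sequence of row `s` and column `c`. -/
def RectSYT.arrowStep (T : RectSYT k n) (s : Fin k) (c i : ℕ) : Option Arrow :=
  if T.count (i + 1) s = c then stepArrow s (T.rowAt i) (T.rowAt (i + 1)) else none

/-- The encoding after `t` steps. -/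
def RectSYT.encodingUpTo (T : RectSYT k n) (s : Fin k) (c t : ℕ) : List Arrow :=
  (if 0 < s.val ∧ c = 0 then [Arrow.up] else []) ++ (List.range t).filterMap (T.arrowStep s c)

theorem RectSYT.encoding_eq (T : RectSYT k n) (s : Fin k) (c : Fin (n + 1)) :
    T.encoding s c = T.encodingUpTo s c (k * n) := by
  unfold RectSYT.encoding RectSYT.encodingUpTo
  rw [← List.map_coe_finRange_eq_range, List.filterMap_map]
  congr 1
  refine List.filterMap_congr fun i _ => ?_
  have h1 : T.nextRow i = T.rowAt (i + 1) := rfl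
  have h2 : (T.rowOf i).val = T.rowAt i := by simp [RectSYT.rowAt]
  rw [RectSYT.arrowAt, h1, h2, T.filled_eq]
  rfl

theorem RectSYT.encodingUpTo_succ (T : RectSYT k n) (s : Fin k) (c t : ℕ) :
    T.encodingUpTo s c (t + 1) = T.encodingUpTo s c t ++ (T.arrowStep s c t).toList := by
  unfold RectSYT.encodingUpTo
  rw [List.range_succ, List.filterMap_append, List.append_assoc]
  congr 2
theorem RectSYT.encodingUpTo_add (T : RectSYT k n) (s : Fin k) (c t u : ℕ) :
    T.encodingUpTo s c (t + u) =
      T.encodingUpTo s c t ++ (List.range u).filterMap fun i => T.arrowStep s c (t + i) := by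
  unfold RectSYT.encodingUpTo
  rw [List.range_add, List.filterMap_append, List.append_assoc, List.filterMap_map]
  rfl

/-- The walk is reconstructed step by step. Known rows determine the counts and the arrows already
written, hence the unread rest of every sequence. The row reached next has nothing left to read in
its current column, whereas every row crossed shows the direction of the step. -/
theorem RectSYT.encoding_injective : Function.Injective (RectSYT.encoding (k := k) (n := n)) := by
  intro T T' h
  refine RectSYT.ext_of_rowAt fun i => ?_
  induction i using Nat.strong_induction_on with
  | _ i ih =>
  intro hi
  have hk : 1 ≤ k := Nat.pos_of_ne_zero fun h0 => by simp [h0] at hi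
  rcases Nat.eq_zero_or_pos i with rfl | hpos
  · rw [T.rowAt_zero hi, T'.rowAt_zero hi]
  obtain ⟨t, rfl⟩ : ∃ t, i = t + 1 := ⟨i - 1, by omega⟩
  clear hpos
  obtain ⟨m, hm⟩ : ∃ m, k * n = t + (m + 1) := ⟨k * n - t - 1, by omega⟩
  have hc : ∀ u ≤ t + 1, ∀ s, T.count u s = T'.count u s := by
    intro u
    induction u with
    | zero => simp [RectSYT.count_zero]
    | succ u ihu =>
      intro hu s
      by_cases h1 : T.rowAt u = s
      · rw [T.count_succ_of_eq s (by omega) h1,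
          T'.count_succ_of_eq s (by omega) (by rw [← ih u (by omega) (by omega), h1]),
          ihu (by omega)]
      · rw [T.count_succ_of_ne s h1,
          T'.count_succ_of_ne s (by rwa [← ih u (by omega) (by omega)]), ihu (by omega)]
  have htail : ∀ (s : Fin k) (c : ℕ), c ≤ n →
      ((List.range (m + 1)).filterMap fun i => T.arrowStep s c (t + i)) =
      (List.range (m + 1)).filterMap fun i => T'.arrowStep s c (t + i) := by
    intro s c hcn
    have h1 := congrFun (congrFun h s) ⟨c, by omega⟩
    rw [T.encoding_eq, T'.encoding_eq, hm, T.encodingUpTo_add, T'.encodingUpTo_add] at h1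
    have h2 : T.encodingUpTo s c t = T'.encodingUpTo s c t := by
      unfold RectSYT.encodingUpTo
      congr 1
      refine List.filterMap_congr fun i hi => ?_
      rw [List.mem_range] at hi
      unfold RectSYT.arrowStep
      rw [hc _ (by omega), ih i (by omega) (by omega), ih (i + 1) (by omega) (by omega)]
    simp only [h2] at h1
    exact List.append_cancel_left h1
  have ha := ih t (by omega) (by omega)
  -- A step puts no arrow in the row where it arrives, and the entry placed there moves that row on
  -- to its next column.
  have hnil : ∀ (T : RectSYT k n) (s : Fin k), T.rowAt (t + 1) = s →
      ((List.range (m + 1)).filterMap fun i => T.arrowStep s (T.count (t + 1) s) (t + i)) = [] := by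
    intro T s hs
    rw [List.filterMap_eq_nil_iff]
    intro i _
    unfold RectSYT.arrowStep
    rcases Nat.eq_zero_or_pos i with rfl | hpos
    · simp only [Nat.add_zero, if_true]
      unfold stepArrow
      rw [if_neg (by omega), if_neg (by omega)]
    · rw [if_neg]
      have h1 := T.count_succ_of_eq s hi hs
      have h2 := T.count_mono s (show t + 1 + 1 ≤ t + i + 1 by omega)
      omega
  have hcons : ∀ (T : RectSYT k n) (s : Fin k) (x : Arrow),
      stepArrow s (T.rowAt t) (T.rowAt (t + 1)) = some x →
      ((List.range (m + 1)).filterMap fun i =>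
        T.arrowStep s (T.count (t + 1) s) (t + i)).head? = some x := by
    intro T s x hx
    rw [List.range_succ_eq_map, List.filterMap_cons_some (b := x)]
    · rfl
    · simp [RectSYT.arrowStep, hx]
  have hcn : ∀ (T : RectSYT k n) s, T.count (t + 1) s ≤ n := fun T s => by
    exact (T.count_mono s (by omega)).trans (T.count_top s).le
  -- Suppose that from row a the walks go to b < b'. If a ≤ b, only T' puts an arrow in row b; if b'
  -- ≤ a, only T puts one in row b'; otherwise row a gets opposite arrows.
  have main : ∀ T T' : RectSYT k n, T.rowAt t = T'.rowAt t →
      (∀ s, T.count (t + 1) s = T'.count (t + 1) s) →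
      (∀ (s : Fin k) (c : ℕ), c ≤ n →
        ((List.range (m + 1)).filterMap fun i => T.arrowStep s c (t + i)) =
        (List.range (m + 1)).filterMap fun i => T'.arrowStep s c (t + i)) →
      ¬ T.rowAt (t + 1) < T'.rowAt (t + 1) := by
    intro T T' ha hc htail hlt
    have hb := T.rowAt_lt hk (t + 1)
    have hb' := T'.rowAt_lt hk (t + 1)
    have ha' := T'.rowAt_lt hk t
    rcases le_or_gt (T.rowAt t) (T.rowAt (t + 1)) with h1 | h1
    · have h2 := hcons T' ⟨T.rowAt (t + 1), hb⟩ Arrow.down (by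
        unfold stepArrow
        rw [if_pos]
        simp only
        omega)
      rw [← htail _ _ (hcn _ _), ← hc, hnil T _ rfl] at h2
      simp at h2
    · rcases le_or_gt (T'.rowAt (t + 1)) (T.rowAt t) with h3 | h3
      · have h2 := hcons T ⟨T'.rowAt (t + 1), hb'⟩ Arrow.up (by
          unfold stepArrow
          rw [if_neg, if_pos] <;> simp only <;> omega)
        rw [htail _ _ (hcn _ _), hc, hnil T' _ rfl] at h2
        simp at h2
      · have h4 := hcons T ⟨T'.rowAt t, ha'⟩ Arrow.up (by
          unfold stepArrow
          rw [if_neg, if_pos] <;> simp only <;> omega)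
        have h5 := hcons T' ⟨T'.rowAt t, ha'⟩ Arrow.down (by
          unfold stepArrow
          rw [if_pos]
          simp only
          omega)
        rw [htail _ _ (hcn _ _), hc, h5] at h4
        simp at h4
  have h1 := main T T' ha (hc _ le_rfl) htail
  have h2 := main T' T ha.symm (fun s => (hc _ le_rfl s).symm) fun s c hcn => (htail s c hcn).symm
  omega

/-! ### The shape of the arrow sequences -/

/-- An alternating sequence of arrows: `j` copies of `↓↑`, with an optional `↑` in front and an
optional `↓` at the end. -/
def zigzag (e : Bool) (j : ℕ) (d : Bool) : List Arrow :=
  (if e then [Arrow.up] else []) ++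
    ((List.replicate j [Arrow.down, Arrow.up]).flatten ++ if d then [Arrow.down] else [])

theorem zigzag_append_down (e : Bool) (j : ℕ) :
    zigzag e j false ++ [Arrow.down] = zigzag e j true := by
  simp [zigzag]

theorem zigzag_append_up (e : Bool) (j : ℕ) :
    zigzag e j true ++ [Arrow.up] = zigzag e (j + 1) false := by
  simp [zigzag, List.replicate_succ']

theorem head?_zigzag (e : Bool) (j : ℕ) (d : Bool) :
    (zigzag e j d).head? = some Arrow.up ↔ e = true := by
  cases e <;> cases j <;> cases d <;> simp [zigzag, List.replicate_succ]

theorem getLast?_zigzag (e : Bool) (j : ℕ) (d : Bool) :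
    (zigzag e j d).getLast? = some Arrow.down ↔ d = true := by
  cases d
  · cases j
    · cases e <;> simp [zigzag]
    · simp [← zigzag_append_up]
  · simp [← zigzag_append_down]

theorem tail_zigzag (j : ℕ) (d : Bool) : (zigzag true j d).tail = zigzag false j d := by
  simp [zigzag]

theorem dropLast_zigzag (e : Bool) (j : ℕ) : (zigzag e j true).dropLast = zigzag e j false := by
  rw [← zigzag_append_down, List.dropLast_concat]

theorem up_cons_zigzag (j : ℕ) (d : Bool) : Arrow.up :: zigzag false j d = zigzag true j d := by
  simp [zigzag]

/-- In terms of the two adjacent boundary bits the three cases of the rule are one: exchange and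
negate. -/
theorem negSwap_zigzag (e j d e' j' d') :
    negSwap (zigzag e j d) (zigzag e' j' d') = (zigzag e j (!e'), zigzag (!d) j' d') := by
  unfold negSwap
  simp only [ne_eq, head?_zigzag, getLast?_zigzag]
  cases d <;> cases e' <;>
    simp [tail_zigzag, dropLast_zigzag, up_cons_zigzag, zigzag_append_down]

-- The sequence is written while row `s` has `c` entries. Leaving the `c`-th cell upwards gives the
-- leading ↑ (supplied initially for `c = 0`). Each jump from below the row to above it completes a
-- pair ↓↑. A final ↓ is unmatched while the walk is below the row, and stays so if the walk then
-- enters the row. Treating all times `t` makes this an induction.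
open Classical in
theorem RectSYT.encodingUpTo_eq (T : RectSYT k n) (hN : 0 < k * n) (s : Fin k)
    (c t : ℕ) (ht : t ≤ k * n) :
    (T.count t s < c → T.encodingUpTo s c t = []) ∧
    (c ≤ T.count t s → T.encodingUpTo s c t = zigzag
      (decide ((c = 0 ∧ 0 < s.val) ∨
        ∃ i < t, T.count (i + 1) s = c ∧ T.rowAt i = s ∧ T.rowAt (i + 1) < s))
      ((Finset.range t).filter fun i =>
        T.count (i + 1) s = c ∧ s < T.rowAt i ∧ T.rowAt (i + 1) < s).card
      (decide ((T.count t s = c ∧ s < T.rowAt t) ∨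
        ∃ i < t, T.count (i + 1) s = c ∧ s < T.rowAt i ∧ T.rowAt (i + 1) = s))) := by
  induction t with
  | zero =>
    rw [T.count_zero]
    refine ⟨fun h => ?_, fun h => ?_⟩
    · simp [RectSYT.encodingUpTo, h.ne']
    · obtain rfl : c = 0 := by omega
      have : ¬ s.val < T.rowAt 0 := by
        rw [T.rowAt_zero hN]; omega
      simp [RectSYT.encodingUpTo, zigzag, this]
  | succ t ih =>
    obtain ⟨ih1, ih2⟩ := ih (by omega)
    have hmono := fun i (hi : i + 1 ≤ t) => T.count_mono s hi
    rw [T.encodingUpTo_succ]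
    unfold RectSYT.arrowStep
    simp only [Nat.exists_lt_succ_right, Finset.range_add_one, Finset.filter_insert]
    rcases lt_trichotomy (T.count (t + 1) s) c with hlt | heq | hgt
    · have := T.count_mono s (show t ≤ t + 1 by omega)
      rw [if_neg hlt.ne, ih1 (by omega)]
      exact ⟨fun _ => rfl, fun h => by omega⟩
    · refine ⟨fun h => by omega, fun _ => ?_⟩
      rw [if_pos heq]
      -- If the step leaves row `s` itself, the `c`-th entry has just been placed and the sequence
      -- was empty so far; otherwise the sequence is being continued.
      by_cases ha : T.rowAt t = s
      · have hc := T.count_succ_of_eq s (by omega) ha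
        have hne : ∀ i < t, T.count (i + 1) s ≠ c := fun i hi h => by
          have := hmono i hi
          omega
        have h1 : ∀ P : ℕ → Prop, (∃ i < t, T.count (i + 1) s = c ∧ P i) ↔ False := fun P =>
          ⟨fun ⟨i, hi, h, _⟩ => hne i hi h, False.elim⟩
        have h2 : ((Finset.range t).filter fun i =>
            T.count (i + 1) s = c ∧ s < T.rowAt i ∧ T.rowAt (i + 1) < s) = ∅ := by
          rw [Finset.filter_eq_empty_iff]
          intro i hi h
          exact hne i (Finset.mem_range.1 hi) h.1
        have h3 : c ≠ 0 := by omega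
        rw [ih1 (by omega)]
        simp only [h1, h2, h3, ha, heq, lt_irrefl, false_and, and_false, if_false, or_false,
          false_or, true_and, Finset.card_empty, stepArrow, le_refl, and_true]
        rcases lt_trichotomy (T.rowAt (t + 1)) s with h | h | h
        · simp [h, h.not_gt, zigzag]
        · simp [h, zigzag]
        · simp [h, h.not_gt, zigzag]
      · have hc := T.count_succ_of_ne s ha
        have hne : ¬ ∃ i < t, T.count (i + 1) s = c ∧ s < T.rowAt i ∧ T.rowAt (i + 1) = s := by
          rintro ⟨i, hi, h, -, h'⟩
          have hit : i + 1 ≠ t := fun h => ha (h ▸ h')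
          have := T.count_succ_of_eq s (by omega) h'
          have := hmono (i + 1) (by omega)
          omega
        rw [ih2 (by omega)]
        simp only [hne, ha, heq, ← hc, true_and, false_and, and_false, or_false, false_or]
        rcases lt_or_gt_of_ne ha with ha' | ha'
        · rw [if_neg (by omega)]
          rcases lt_or_ge s.val (T.rowAt (t + 1)) with h | h
          · have h1 : stepArrow s (T.rowAt t) (T.rowAt (t + 1)) = some Arrow.down :=
              if_pos ⟨by omega, h⟩
            have h2 : ¬ s.val < T.rowAt t := by omega
            simp [h1, h2, h, zigzag_append_down]
          · have h1 : stepArrow s (T.rowAt t) (T.rowAt (t + 1)) = none := by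
              rw [stepArrow, if_neg (by omega), if_neg (by omega)]
            have h2 : ¬ s.val < T.rowAt t := by omega
            simp [h1, h2, h.not_gt]
        · rcases lt_or_ge (T.rowAt (t + 1)) s with h | h
          · have h1 : stepArrow s (T.rowAt t) (T.rowAt (t + 1)) = some Arrow.up := by
              rw [stepArrow, if_neg (by omega), if_pos (by omega)]
            have h2 : ¬ T.rowAt (t + 1) = s := by omega
            rw [if_pos ⟨ha', h⟩, Finset.card_insert_of_notMem (by simp)]
            simp [h1, ha', h2, h.not_gt, zigzag_append_up]
          · have h1 : stepArrow s (T.rowAt t) (T.rowAt (t + 1)) = none := by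
              rw [stepArrow, if_neg (by omega), if_neg (by omega)]
            have h2 : (s.val < T.rowAt (t + 1) ∨ T.rowAt (t + 1) = s) ↔ True := by
              simp only [iff_true]; omega
            rw [if_neg (by omega)]
            simp [h1, ha', h2]
    · refine ⟨fun h => by omega, fun _ => ?_⟩
      have hc : c ≤ T.count t s := by
        by_cases ha : T.rowAt t = s
        · have := T.count_succ_of_eq s (by omega) ha
          omega
        · have := T.count_succ_of_ne s ha
          omega
      have hd : ¬ (T.count t s = c ∧ s < T.rowAt t) := by
        rintro ⟨h1, h2⟩
        have := T.count_succ_of_ne s h2.ne'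
        omega
      rw [ih2 hc]
      simp [hgt.ne', hd]

/-! ### The data that determine the encoding -/

/-- The entry before that of `p` lies in a row strictly below row `s`. -/
def RectSYT.EnterBelow (T : RectSYT k n) (s : Fin k) (p : Fin k × Fin n) : Prop :=
  ∃ q, (T.entry q).val + 1 = T.entry p ∧ s < q.1

/-- The entry after that of `p` lies in a row strictly above row `s`. -/
def RectSYT.ExitAbove (T : RectSYT k n) (s : Fin k) (p : Fin k × Fin n) : Prop :=
  ∃ q, (T.entry p).val + 1 = T.entry q ∧ q.1 < s

open Classical in
/-- Whether the arrow sequence of row `s` and column `c` starts with `↑`. -/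
noncomputable def RectSYT.startsUp (T : RectSYT k n) (s : Fin k) (c : ℕ) : Bool :=
  decide ((c = 0 ∧ 0 < s.val) ∨ ∃ c' : Fin n, c'.val + 1 = c ∧ T.ExitAbove s (s, c'))

open Classical in
/-- Whether the arrow sequence of row `s` and column `c` ends with `↓`. -/
noncomputable def RectSYT.endsDown (T : RectSYT k n) (s : Fin k) (c : ℕ) : Bool :=
  decide ((c = n ∧ s.val < k - 1) ∨ ∃ c' : Fin n, c'.val = c ∧ T.EnterBelow s (s, c'))

open Classical in
/-- The number of upward steps that jump over row `s` when it has `c` entries. -/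
noncomputable def RectSYT.jumps (T : RectSYT k n) (s : Fin k) (c : ℕ) : ℕ :=
  (Finset.univ.filter fun p : Fin k × Fin n =>
    p.1 < s ∧ T.EnterBelow s p ∧ T.count (T.entry p) s = c).card

/-- This is the end of the walk, with steps renamed by cells. The conventional last position in the
bottom row accounts for the clause `c = n` of `endsDown`; the steps counted by the other clauses all
lead to genuine cells. -/
theorem RectSYT.encoding_eq_zigzag (hN : 0 < k * n) (T : RectSYT k n) (s : Fin k)
    (c : Fin (n + 1)) :
    T.encoding s c = zigzag (T.startsUp s c) (T.jumps s c) (T.endsDown s c) := by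
  classical
  have hk : 1 ≤ k := Nat.pos_of_ne_zero fun h0 => by simp [h0] at hN
  rw [T.encoding_eq, (T.encodingUpTo_eq hN s c _ le_rfl).2
    (by rw [T.count_top]; exact Nat.lt_succ_iff.1 c.2)]
  have hs := s.2
  have hnext : ∀ i, i < k * n → T.rowAt (i + 1) < s → ∃ p, (T.entry p).val = i + 1 := by
    intro i hi h
    refine T.exists_entry (lt_of_le_of_ne hi fun h1 => ?_)
    rw [h1, T.rowAt_top] at h
    omega
  congr 1
  · unfold RectSYT.startsUp
    refine decide_eq_decide.2 (or_congr Iff.rfl ⟨?_, ?_⟩)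
    · rintro ⟨i, hi, h1, h2, h3⟩
      obtain ⟨q, hq⟩ := hnext i hi h3
      obtain ⟨⟨r, c'⟩, rfl⟩ := T.exists_entry hi
      rw [T.rowAt_entry] at h2
      obtain rfl : r = s := Fin.ext h2
      rw [T.count_succ_of_eq _ hi (T.rowAt_entry _), T.count_entry] at h1
      refine ⟨c', h1, q, hq.symm, ?_⟩
      rw [← hq, T.rowAt_entry] at h3
      exact h3
    · rintro ⟨c', h1, q, hq, h2⟩
      refine ⟨T.entry (s, c'), Fin.is_lt _, ?_, T.rowAt_entry _, ?_⟩
      · rw [T.count_succ_of_eq _ (Fin.is_lt _) (T.rowAt_entry _), T.count_entry, h1]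
      · rw [hq, T.rowAt_entry]
        exact h2
  · unfold RectSYT.jumps
    symm
    refine Finset.card_bij (fun p _ => (T.entry p).val - 1) ?_ ?_ ?_
    · intro p hp
      simp only [Finset.mem_filter, Finset.mem_univ, true_and] at hp
      obtain ⟨h1, ⟨q, hq, h2⟩, h3⟩ := hp
      rw [← hq, Nat.add_sub_cancel, Finset.mem_filter, Finset.mem_range, hq, h3, T.rowAt_entry,
        T.rowAt_entry]
      exact ⟨Fin.is_lt _, rfl, h2, h1⟩
    · intro p hp q hq h
      simp only [Finset.mem_filter, Finset.mem_univ, true_and] at hp hq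
      obtain ⟨-, ⟨p', hp, -⟩, -⟩ := hp
      obtain ⟨-, ⟨q', hq, -⟩, -⟩ := hq
      apply T.entry.injective
      apply Fin.ext
      omega
    · intro i hi
      rw [Finset.mem_filter, Finset.mem_range] at hi
      obtain ⟨hi, h1, h2, h3⟩ := hi
      obtain ⟨q, hq⟩ := hnext i hi h3
      refine ⟨q, ?_, by omega⟩
      simp only [Finset.mem_filter, Finset.mem_univ, true_and]
      rw [← hq, T.rowAt_entry] at h3
      refine ⟨h3, ?_, by rw [hq]; exact h1⟩
      obtain ⟨p, rfl⟩ := T.exists_entry hi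
      rw [T.rowAt_entry] at h2
      exact ⟨p, hq.symm, h2⟩
  · unfold RectSYT.endsDown
    refine decide_eq_decide.2 (or_congr ?_ ⟨?_, ?_⟩)
    · rw [T.count_top, T.rowAt_top, eq_comm]
    · rintro ⟨i, hi, h1, h2, h3⟩
      have hi1 : i + 1 < k * n := lt_of_le_of_ne hi fun h => by
        rw [h, T.rowAt_top] at h3
        have := T.rowAt_lt hk i
        omega
      obtain ⟨⟨r, c'⟩, hq⟩ := T.exists_entry hi1
      obtain ⟨p, rfl⟩ := T.exists_entry hi
      rw [← hq, T.rowAt_entry] at h3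
      obtain rfl : r = s := Fin.ext h3
      rw [T.rowAt_entry] at h2
      rw [← hq, T.count_entry] at h1
      exact ⟨c', h1, p, hq.symm, h2⟩
    · rintro ⟨c', h1, q, hq, h2⟩
      refine ⟨T.entry q, Fin.is_lt _, ?_, ?_, ?_⟩
      · rw [hq, T.count_entry, h1]
      · rw [T.rowAt_entry]; exact h2
      · rw [hq, T.rowAt_entry]

/-! ### Ascents -/

open Classical in
theorem RectSYT.asc_eq_card_exitAbove (T : RectSYT k n) :
    T.asc = (Finset.univ.filter fun p : Fin k × Fin n => T.ExitAbove p.1 p).card := by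
  symm
  refine Finset.card_equiv T.entry fun p => ?_
  rw [Finset.mem_filter, Finset.mem_filter]
  simp only [Finset.mem_univ, true_and, RectSYT.rowOf, Equiv.symm_apply_apply]
  constructor
  · rintro ⟨q, hq, h⟩
    have h1 := (T.entry q).2
    refine ⟨by omega, ?_⟩
    simpa [hq] using h
  · rintro ⟨h1, h⟩
    exact ⟨T.entry.symm ⟨_, h1⟩, by simp, h⟩

-- Every ascent leaves one cell upwards and enters the following one from below.
open Classical in
theorem RectSYT.card_exitAbove_eq (T : RectSYT k n) :
    (Finset.univ.filter fun p : Fin k × Fin n => T.ExitAbove p.1 p).card =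
    (Finset.univ.filter fun p : Fin k × Fin n => T.EnterBelow p.1 p).card := by
  have h1 : ∀ p, p ∈ (Finset.univ.filter fun p : Fin k × Fin n => T.ExitAbove p.1 p) →
      ∃ q, (T.entry p).val + 1 = T.entry q ∧ q.1 < p.1 := fun p hp =>
    (Finset.mem_filter.1 hp).2
  choose! f hf using h1
  refine Finset.card_bij (fun p _ => f p) ?_ ?_ ?_
  · intro p hp
    simp only [Finset.mem_filter, Finset.mem_univ, true_and]
    exact ⟨p, hf p hp⟩
  · intro p hp q hq h
    have h1 := (hf p hp).1
    have h2 := (hf q hq).1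
    rw [h] at h1
    exact T.entry.injective (Fin.ext (by omega))
  · intro q hq
    simp only [Finset.mem_filter, Finset.mem_univ, true_and] at hq
    obtain ⟨p, hp, h⟩ := hq
    have hmem : p ∈ (Finset.univ.filter fun p : Fin k × Fin n => T.ExitAbove p.1 p) := by
      simp only [Finset.mem_filter, Finset.mem_univ, true_and]
      exact ⟨q, hp, h⟩
    refine ⟨p, hmem, T.entry.injective (Fin.ext ?_)⟩
    rw [← (hf p hmem).1, hp]

/-- No cell of the top row is left upwards, so the other rows see all ascents; the extra k - 1 are
the initial ↑ in column 0. -/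
theorem RectSYT.sum_startsUp (T : RectSYT k n) :
    ∑ r : Fin (k - 1), ∑ c : Fin (n + 1), (T.startsUp ⟨r.val + 1, by omega⟩ c).toNat =
      T.asc + (k - 1) := by
  classical
  rcases k with - | k
  · simp [RectSYT.asc_eq_card_exitAbove]
  have h0 : ∀ c, ¬ T.ExitAbove 0 (0, c) := by
    rintro c ⟨q, -, h⟩
    exact absurd h (Fin.not_lt_zero _)
  rw [T.asc_eq_card_exitAbove, Finset.card_filter, Fintype.sum_prod_type, Fin.sum_univ_succ]
  simp only [h0, if_false, Finset.sum_const_zero, zero_add, Fin.sum_univ_succ (n := n),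
    Finset.sum_add_distrib]
  rw [add_comm]
  congr 1
  · refine Finset.sum_congr rfl fun r _ => Finset.sum_congr rfl fun c _ => ?_
    have : T.startsUp r.succ c.succ = decide (T.ExitAbove r.succ (r.succ, c)) := by
      refine decide_eq_decide.2 ?_
      simp [← Fin.ext_iff]
    rw [show (⟨r.val + 1, by omega⟩ : Fin (k + 1)) = r.succ from rfl, this]
    by_cases h : T.ExitAbove r.succ (r.succ, c) <;> simp [h]
  · simp [RectSYT.startsUp]

/-- Dually, no cell of the bottom row is entered from below, and the extra k - 1 are the final ↓ in
column n. -/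
theorem RectSYT.sum_endsDown (T : RectSYT k n) :
    ∑ r : Fin (k - 1), ∑ c : Fin (n + 1), (T.endsDown ⟨r.val, by omega⟩ c).toNat =
      T.asc + (k - 1) := by
  classical
  rcases k with - | k
  · simp [RectSYT.asc_eq_card_exitAbove]
  have h0 : ∀ c, ¬ T.EnterBelow (Fin.last k) (Fin.last k, c) := by
    rintro c ⟨q, -, h⟩
    exact absurd h (Fin.le_last _).not_gt
  rw [T.asc_eq_card_exitAbove, T.card_exitAbove_eq, Finset.card_filter, Fintype.sum_prod_type,
    Fin.sum_univ_castSucc]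
  simp only [h0, if_false, Finset.sum_const_zero, add_zero, Fin.sum_univ_castSucc (n := n),
    Finset.sum_add_distrib]
  congr 1
  · refine Finset.sum_congr rfl fun r _ => Finset.sum_congr rfl fun c _ => ?_
    have : T.endsDown r.castSucc c.castSucc = decide (T.EnterBelow r.castSucc (r.castSucc, c)) := by
      refine decide_eq_decide.2 ?_
      simp [← Fin.ext_iff, c.2.ne]
    rw [show (⟨r.val, by omega⟩ : Fin (k + 1)) = r.castSucc from rfl, this]
    by_cases h : T.EnterBelow r.castSucc (r.castSucc, c) <;> simp [h]
  · simp [RectSYT.endsDown]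

/-! ### Recutting the upper and the lower rows of a tableau -/

theorem RectSYT.exists_pred (T : RectSYT k n) {p q : Fin k × Fin n} (h : T.entry p < T.entry q) :
    ∃ z, (T.entry z).val + 1 = T.entry q := by
  obtain ⟨z, hz⟩ := T.exists_entry (i := (T.entry q).val - 1) (by omega)
  rw [Fin.lt_def] at h
  exact ⟨z, by omega⟩

theorem RectSYT.exists_succ (T : RectSYT k n) {p q : Fin k × Fin n} (h : T.entry p < T.entry q) :
    ∃ z, (T.entry p).val + 1 = T.entry z := by
  rw [Fin.lt_def] at h
  obtain ⟨z, hz⟩ := T.exists_entry (i := (T.entry p).val + 1) (by omega)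
  exact ⟨z, hz.symm⟩

/-- Ranks are injective on `S` with values below `S.card`, hence take every such value. -/
theorem exists_card_lt_eq {α : Type*} [DecidableEq α] (S : Finset α) (f : α → ℕ)
    (hf : Function.Injective f) {i : ℕ} (hi : i < S.card) :
    ∃ s ∈ S, (S.filter fun x => f x < f s).card = i := by
  have hlt : ∀ s ∈ S, ∀ t ∈ S, f s < f t →
      (S.filter fun x => f x < f s).card < (S.filter fun x => f x < f t).card := by
    intro s hs t ht h
    refine Finset.card_lt_card ⟨fun x => ?_, fun h' => ?_⟩
    · simp only [Finset.mem_filter]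
      exact fun hx => ⟨hx.1, hx.2.trans h⟩
    · have := @h' s (by simp [hs, h])
      simp at this
  have hsurj := Finset.surjOn_of_injOn_of_card_le (s := S) (t := Finset.range S.card)
    (fun s => (S.filter fun x => f x < f s).card)
    (fun s hs => by
      simp only [Finset.coe_range, Set.mem_Iio]
      refine Finset.card_lt_card ⟨Finset.filter_subset _ _, fun h => ?_⟩
      have := h hs
      simp at this)
    (fun s hs t ht h => by
      rcases lt_trichotomy (f s) (f t) with h1 | h1 | h1
      · exact absurd h (hlt s hs t ht h1).ne
      · exact hf h1
      · exact absurd h (hlt t ht s hs h1).ne')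
    (by simp)
  obtain ⟨s, hs, h⟩ := hsurj (by simpa using hi : i ∈ (Finset.range S.card : Set ℕ))
  exact ⟨s, hs, h⟩

open Classical in
/-- The number of elements with a given property. -/
noncomputable def cardOf {α : Type*} [Fintype α] (p : α → Prop) : ℕ :=
  (Finset.univ.filter p).card

theorem cardOf_eq_card {α : Type*} [Fintype α] {p : α → Prop} (S : Finset α)
    (h : ∀ x, x ∈ S ↔ p x) : cardOf p = S.card := by
  unfold cardOf
  congr 1
  ext x
  simp [h]

theorem cardOf_le_of_injOn {α β : Type*} [Fintype α] [Fintype β] {p : α → Prop} {q : β → Prop}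
    (f : α → β) (h1 : ∀ x, p x → q (f x)) (h2 : ∀ x y, p x → p y → f x = f y → x = y) :
    cardOf p ≤ cardOf q := by
  unfold cardOf
  refine Finset.card_le_card_of_injOn f (fun x hx => ?_) fun x hx y hy h => ?_
  · simpa using h1 x (by simpa using hx)
  · exact h2 x y (by simpa using hx) (by simpa using hy) h

theorem cardOf_eq_of_bijOn {α β : Type*} [Fintype α] [Fintype β] {p : α → Prop} {q : β → Prop}
    (f : α → β) (h1 : ∀ x, p x → q (f x)) (h2 : ∀ x y, p x → p y → f x = f y → x = y)
    (h3 : ∀ y, q y → ∃ x, p x ∧ f x = y) : cardOf p = cardOf q := by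
  unfold cardOf
  refine Finset.card_bij (fun x _ => f x) (fun x hx => ?_) (fun x hx y hy h => ?_) fun y hy => ?_
  · simpa using h1 x (by simpa using hx)
  · exact h2 x y (by simpa using hx) (by simpa using hy) h
  · obtain ⟨x, hx, h⟩ := h3 y (by simpa using hy)
    exact ⟨x, by simpa using hx, h⟩

open Classical in
/-- Cut the entries in the rows up to `a` before the cells in `S`, the entries in the other rows
after the cells in `E`, and let the resulting blocks alternate. -/
theorem RectSYT.exists_recut (T : RectSYT k n) (a b : Fin k) (hab : b.val = a.val + 1)
    (S E : Fin k × Fin n → Prop)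
    (hcol : ∀ c : Fin n,
      cardOf (fun x : Fin k × Fin n =>
        x.1 ≤ a ∧ S x ∧ T.entry x ≤ T.entry (a, c)) ≤
      cardOf (fun y : Fin k × Fin n =>
        a < y.1 ∧ E y ∧ T.entry y < T.entry (b, c)))
    (hcard : cardOf (fun x : Fin k × Fin n => x.1 ≤ a ∧ S x) =
      cardOf (fun y : Fin k × Fin n => a < y.1 ∧ E y)) :
    ∃ T' : RectSYT k n,
      (∀ p q : Fin k × Fin n, (p.1 ≤ a ↔ q.1 ≤ a) →
        (T'.entry p < T'.entry q ↔ T.entry p < T.entry q)) ∧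
      (∀ x : Fin k × Fin n, x.1 ≤ a → (T'.EnterBelow a x ↔ S x)) ∧
      (∀ y : Fin k × Fin n, a < y.1 → (T'.ExitAbove b y ↔ E y)) := by
  set X : Finset (Fin k × Fin n) := Finset.univ.filter fun x => x.1 ≤ a ∧ S x with hX
  set Y : Finset (Fin k × Fin n) := Finset.univ.filter fun y => a < y.1 ∧ E y with hY
  have memX : ∀ x, x ∈ X ↔ x.1 ≤ a ∧ S x := fun x => by simp [hX]
  have memY : ∀ x, x ∈ Y ↔ a < x.1 ∧ E x := fun x => by simp [hY]
  rw [cardOf_eq_card X memX, cardOf_eq_card Y memY] at hcard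
  let t : Fin k × Fin n → ℕ := fun p => (T.entry p).val
  have tinj : Function.Injective t := fun p q h => T.entry.injective (Fin.ext h)
  -- Block indices. A cell of `S` opens its block, so it counts for itself; a cell of `E` closes its
  -- block, so it counts only for later cells.
  let BX : Fin k × Fin n → ℕ := fun p => (X.filter fun x => t x ≤ t p).card
  let BY : Fin k × Fin n → ℕ := fun p => (Y.filter fun y => t y < t p).card
  have BXmono : ∀ p q, t p ≤ t q → BX p ≤ BX q := fun p q h =>
    Finset.card_le_card fun x => by
      simp only [Finset.mem_filter]
      exact fun hx => ⟨hx.1, hx.2.trans h⟩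
  have BYmono : ∀ p q, t p ≤ t q → BY p ≤ BY q := fun p q h =>
    Finset.card_le_card fun x => by
      simp only [Finset.mem_filter]
      exact fun hx => ⟨hx.1, hx.2.trans_le h⟩
  have BXlt : ∀ p q, t p < t q → q ∈ X → BX p < BX q := fun p q h hq => by
    refine Finset.card_lt_card ⟨fun x => ?_, fun h' => ?_⟩
    · simp only [Finset.mem_filter]
      exact fun hx => ⟨hx.1, hx.2.trans h.le⟩
    · have := @h' q (by simp [hq])
      simp only [Finset.mem_filter] at this
      omega
  have BYlt : ∀ p q, t p < t q → p ∈ Y → BY p < BY q := fun p q h hp => by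
    refine Finset.card_lt_card ⟨fun x => ?_, fun h' => ?_⟩
    · simp only [Finset.mem_filter]
      exact fun hx => ⟨hx.1, hx.2.trans h⟩
    · have := @h' p (by simp [hp, h])
      simp only [Finset.mem_filter] at this
      omega
  have hcol' : ∀ c, BX (a, c) ≤ BY (b, c) := by
    intro c
    have hc := hcol c
    rw [cardOf_eq_card (X.filter fun x => t x ≤ t (a, c)) fun x => by
        rw [Finset.mem_filter, memX, and_assoc]; rfl,
      cardOf_eq_card (Y.filter fun y => t y < t (b, c)) fun y => by
        rw [Finset.mem_filter, memY, and_assoc]; rfl] at hc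
    exact hc
  -- Upper blocks get the even places and lower blocks the odd ones; inside a block the order of `T`
  -- is kept.
  let K : Fin k × Fin n → ℕ := fun p => if p.1 ≤ a then 2 * BX p else 2 * BY p + 1
  let key : Fin k × Fin n → ℕ := fun p => K p * (k * n) + t p
  have hkey : ∀ p q, key p < key q ↔ K p < K q ∨ K p = K q ∧ t p < t q := fun p q =>
    mul_add_lt_iff (Fin.is_lt _) (Fin.is_lt _)
  have KX : ∀ p, p.1 ≤ a → K p = 2 * BX p := fun p hp => if_pos hp
  have KY : ∀ p, a < p.1 → K p = 2 * BY p + 1 := fun p hp => if_neg (not_le.2 hp)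
  have keyX : ∀ p q, p.1 ≤ a → q.1 ≤ a → (key p < key q ↔ t p < t q) := by
    intro p q hp hq
    rw [hkey, KX p hp, KX q hq]
    have h1 := BXmono p q
    have h2 := BXmono q p
    omega
  have keyY : ∀ p q, a < p.1 → a < q.1 → (key p < key q ↔ t p < t q) := by
    intro p q hp hq
    rw [hkey, KY p hp, KY q hq]
    have h1 := BYmono p q
    have h2 := BYmono q p
    omega
  have keyXY : ∀ p q, p.1 ≤ a → a < q.1 → (key p < key q ↔ BX p ≤ BY q) := by
    intro p q hp hq
    rw [hkey, KX p hp, KY q hq]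
    omega
  have keyYX : ∀ p q, a < p.1 → q.1 ≤ a → (key p < key q ↔ BY p < BX q) := by
    intro p q hp hq
    rw [hkey, KY p hp, KX q hq]
    omega
  obtain ⟨T', hT'⟩ := RectSYT.exists_of_key key
    (by
      intro p q h
      have h1 := hkey p q
      have h2 := hkey q p
      rw [h] at h1
      rw [h] at h2
      exact tinj (by omega))
    (by
      intro r c c' h
      have h1 : t (r, c) < t (r, c') := T.row_lt r c c' h
      rcases le_or_gt r a with hr | hr
      · exact (keyX _ _ hr hr).2 h1
      · exact (keyY _ _ hr hr).2 h1)
    (by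
      intro r r' c h
      have h1 : t (r, c) < t (r', c) := T.col_lt r r' c h
      rcases le_or_gt r a with hr | hr
      · rcases le_or_gt r' a with hr' | hr'
        · exact (keyX _ _ hr hr').2 h1
        -- Across the boundary the chain (r, c), (a, c), (b, c), (r', c) reduces the claim to
        -- `hcol`.
        · have h2 := BXmono (r, c) (a, c) (T.le_of_le ⟨hr, le_rfl⟩)
          have h3 := BYmono (b, c) (r', c) (T.le_of_le ⟨by rw [Fin.le_def]; simp only; omega, le_rfl⟩)
          exact (keyXY _ _ hr hr').2 (h2.trans ((hcol' c).trans h3))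
      · exact (keyY _ _ hr (hr.trans h)).2 h1)
  have hbelow : ∀ p : Fin k × Fin n, p.1 < b ↔ p.1 ≤ a := fun p => by
    rw [Fin.lt_def, Fin.le_def]; omega
  refine ⟨T', ?_, ?_, ?_⟩
  · intro p q hpq
    rw [hT']
    rcases le_or_gt p.1 a with hp | hp
    · exact keyX p q hp (hpq.1 hp)
    · exact keyY p q hp (not_le.1 fun hq => not_le.2 hp (hpq.2 hq))
  · intro x hx
    constructor
    · rintro ⟨q, hq, haq⟩
      by_contra hS
      have h1 := (keyYX q x haq hx).1 ((hT' q x).1 (Fin.lt_def.2 (by omega)))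
      -- The last cut before `x` opens the block of `x`, so it would lie strictly between `q` and
      -- `x`.
      have hne : (X.filter fun z => t z ≤ t x).Nonempty :=
        Finset.card_pos.1 (show 0 < BX x by omega)
      obtain ⟨x0, hx0, hmax⟩ := Finset.exists_max_image _ t hne
      rw [Finset.mem_filter] at hx0
      have hx0x : t x0 < t x := lt_of_le_of_ne hx0.2 fun h => by
        rw [tinj h, memX] at hx0
        exact hS hx0.1.2
      have hB : BX x ≤ BX x0 := Finset.card_le_card fun z hz =>
        Finset.mem_filter.2 ⟨(Finset.mem_filter.1 hz).1, hmax z hz⟩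
      have hx0a := ((memX _).1 hx0.1).1
      have h2 := (hT' q x0).2 ((keyYX q x0 haq hx0a).2 (by omega))
      have h3 := (hT' x0 x).2 ((keyX x0 x hx0a hx).2 hx0x)
      rw [Fin.lt_def] at h2 h3
      omega
    · intro hS
      have hxX := (memX x).2 ⟨hx, hS⟩
      have h1 : 0 < BX x := Finset.card_pos.2 ⟨x, by simp [hxX]⟩
      have h2 : BX x ≤ X.card := Finset.card_le_card (Finset.filter_subset _ _)
      -- By equality of the numbers of cuts, the lower block just before that of `x` has a closing
      -- cell; it separates `x` from all earlier upper cells.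
      obtain ⟨y, hy, hyB⟩ := exists_card_lt_eq Y t tinj (i := BX x - 1) (by omega)
      have hya := ((memY _).1 hy).1
      have h3 : BY y = BX x - 1 := hyB
      have hyx := (hT' y x).2 ((keyYX y x hya hx).2 (by omega))
      obtain ⟨q, hq⟩ := T'.exists_pred hyx
      refine ⟨q, hq, ?_⟩
      by_contra! hqa
      have h4 := BXlt q x ((keyX q x hqa hx).1 ((hT' q x).1 (Fin.lt_def.2 (by omega)))) hxX
      have h5 := (hT' q y).2 ((keyXY q y hqa hya).2 (by omega))
      rw [Fin.lt_def] at h5 hyx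
      omega
  · intro y hy
    constructor
    · rintro ⟨q, hq, haq⟩
      rw [hbelow] at haq
      by_contra hE
      have h1 := (keyYX y q hy haq).1 ((hT' y q).1 (Fin.lt_def.2 (by omega)))
      have h2 : BX q ≤ X.card := Finset.card_le_card (Finset.filter_subset _ _)
      -- With no cut at or after `y`, the index of its block would be `Y.card`, and no upper block
      -- comes after that one.
      have hne : (Y.filter fun z => t y ≤ t z).Nonempty := by
        rw [Finset.nonempty_iff_ne_empty]
        intro h
        rw [Finset.filter_eq_empty_iff] at h
        have : BY y = Y.card := by
          simp only [BY]
          rw [Finset.filter_true_of_mem]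
          intro z hz
          exact not_le.1 (h hz)
        omega
      obtain ⟨y0, hy0, hmin⟩ := Finset.exists_min_image _ t hne
      rw [Finset.mem_filter] at hy0
      have hy0y : t y < t y0 := lt_of_le_of_ne hy0.2 fun h => by
        rw [← tinj h, memY] at hy0
        exact hE hy0.1.2
      have hB : BY y0 ≤ BY y := Finset.card_le_card fun z hz => by
        rw [Finset.mem_filter] at hz ⊢
        refine ⟨hz.1, ?_⟩
        by_contra! h
        have := hmin z (Finset.mem_filter.2 ⟨hz.1, h⟩)
        omega
      have hy0a := ((memY _).1 hy0.1).1
      have h2 := (hT' y0 q).2 ((keyYX y0 q hy0a haq).2 (by omega))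
      have h3 := (hT' y y0).2 ((keyY y y0 hy hy0a).2 hy0y)
      rw [Fin.lt_def] at h2 h3
      omega
    · intro hE
      have hyY := (memY y).2 ⟨hy, hE⟩
      have h2 : BY y < Y.card := Finset.card_lt_card ⟨Finset.filter_subset _ _, fun h => by
        have := h hyY
        simp at this⟩
      obtain ⟨x, hx, hxB⟩ := exists_card_lt_eq X t tinj (i := BY y) (by omega)
      have hxa := ((memX _).1 hx).1
      have h3 : BX x = BY y + 1 := by
        rw [← hxB, ← Finset.card_insert_of_notMem (a := x) (by simp)]
        simp only [BX]
        congr 1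
        ext z
        simp only [Finset.mem_filter, Finset.mem_insert, le_iff_lt_or_eq, tinj.eq_iff]
        constructor
        · rintro ⟨h1, h2 | h2⟩
          · exact Or.inr ⟨h1, h2⟩
          · exact Or.inl h2
        · rintro (rfl | h)
          · exact ⟨hx, Or.inr rfl⟩
          · exact ⟨h.1, Or.inl h.2⟩
      have hyx := (hT' y x).2 ((keyYX y x hy hxa).2 (by omega))
      obtain ⟨q, hq⟩ := T'.exists_succ hyx
      refine ⟨q, hq, ?_⟩
      rw [hbelow]
      by_contra! hqa
      have h4 := BYlt y q ((keyY y q hy hqa).1 ((hT' y q).1 (Fin.lt_def.2 (by omega)))) hyY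
      have h5 := (hT' x q).2 ((keyXY x q hxa hqa).2 (by omega))
      rw [Fin.lt_def] at h5 hyx
      omega

/-! ### Counting the cuts -/

/-- This separates the cuts in row `a`, which get negated, from those in the other rows, which stay.
-/
theorem cardOf_split (a : Fin k) (R : Fin k → Prop) (hR : R a) (P : Fin n → Prop)
    (O Q : Fin k × Fin n → Prop) :
    cardOf (fun x : Fin k × Fin n =>
      R x.1 ∧ (if x.1 = a then P x.2 else O x) ∧ Q x) =
    cardOf (fun x : Fin k × Fin n => R x.1 ∧ x.1 ≠ a ∧ O x ∧ Q x) +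
      cardOf (fun c : Fin n => P c ∧ Q (a, c)) := by
  have h2 : cardOf (fun c : Fin n => P c ∧ Q (a, c)) =
      cardOf (fun x : Fin k × Fin n => x.1 = a ∧ P x.2 ∧ Q x) := by
    unfold cardOf
    refine Finset.card_bij (fun c _ => (a, c)) ?_ ?_ ?_
    · intro c hc
      simpa using hc
    · intro c _ c' _ h
      simpa using h
    · rintro ⟨r, c⟩ h
      simp only [Finset.mem_filter, Finset.mem_univ, true_and] at h
      obtain ⟨rfl, h⟩ := h
      exact ⟨c, by simpa using h, rfl⟩
  rw [h2]
  unfold cardOf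
  rw [← Finset.card_union_of_disjoint]
  · congr 1
    ext x
    simp only [Finset.mem_filter, Finset.mem_univ, true_and, Finset.mem_union]
    by_cases h : x.1 = a <;> simp [h, hR]
  · rw [Finset.disjoint_left]
    intro x h1 h2
    simp only [Finset.mem_filter, Finset.mem_univ, true_and] at h1 h2
    exact h1.2.1 h2.1

theorem cardOf_fin_eq_sum (f : ℕ → Bool) (v : Bool) {m : ℕ} (hm : m ≤ n) :
    cardOf (fun c : Fin n => f c = v ∧ c.val < m) =
      ∑ t ∈ Finset.range m, if f t = v then 1 else 0 := by
  rw [← Finset.card_filter]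
  unfold cardOf
  refine Finset.card_bij (fun c _ => c.val) ?_ (fun _ _ _ _ h => Fin.ext h) ?_
  · intro c hc
    simp only [Finset.mem_filter, Finset.mem_univ, true_and, Finset.mem_range] at hc ⊢
    exact hc.symm
  · intro t ht
    simp only [Finset.mem_filter, Finset.mem_range] at ht
    exact ⟨⟨t, by omega⟩, by simpa using ht.symm, rfl⟩

theorem RectSYT.startsUp_zero (T : RectSYT k n) {s : Fin k} (h : 0 < s.val) :
    T.startsUp s 0 = true := by
  simp [RectSYT.startsUp, h]

theorem RectSYT.startsUp_succ (T : RectSYT k n) (s : Fin k) (c : Fin n) :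
    T.startsUp s (c.val + 1) = true ↔ T.ExitAbove s (s, c) := by
  simp [RectSYT.startsUp, ← Fin.ext_iff]

theorem RectSYT.endsDown_top (T : RectSYT k n) {s : Fin k} (h : s.val < k - 1) :
    T.endsDown s n = true := by
  simp [RectSYT.endsDown, h]

theorem RectSYT.endsDown_coe (T : RectSYT k n) (s : Fin k) (c : Fin n) :
    T.endsDown s c.val = true ↔ T.EnterBelow s (s, c) := by
  simp [RectSYT.endsDown, ← Fin.ext_iff, c.2.ne]

/-- The last cell of a row has a larger entry than all cells in the rows above. -/
theorem RectSYT.startsUp_top (T : RectSYT k n) (hn : 1 ≤ n) (s : Fin k) :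
    T.startsUp s n = false := by
  rw [← Bool.not_eq_true]
  intro h
  obtain ⟨⟨r, c⟩, hq, h⟩ := (T.startsUp_succ s ⟨n - 1, by omega⟩).1 (by
    simp only [Nat.sub_add_cancel hn, h])
  have h1 : T.entry (r, c) ≤ T.entry (s, ⟨n - 1, by omega⟩) :=
    T.le_of_le ⟨h.le, by rw [Fin.le_def]; simp only; omega⟩
  rw [Fin.le_def] at h1
  omega

theorem RectSYT.endsDown_zero (T : RectSYT k n) (hn : 1 ≤ n) (s : Fin k) :
    T.endsDown s 0 = false := by
  rw [← Bool.not_eq_true]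
  intro h
  obtain ⟨⟨r, c⟩, hq, h⟩ := (T.endsDown_coe s ⟨0, by omega⟩).1 h
  have h1 : T.entry (s, ⟨0, by omega⟩) ≤ T.entry (r, c) :=
    T.le_of_le ⟨h.le, by rw [Fin.le_def]; simp only; omega⟩
  rw [Fin.le_def] at h1
  omega

/-- Send `x` to its predecessor, which comes before (b, c) because (a, c) does. This is the column
condition of `RectSYT.exists_recut` for the cuts of `T` itself. -/
theorem RectSYT.card_enterBelow_le (T : RectSYT k n) (a b : Fin k) (hab : b.val = a.val + 1)
    (c : Fin n) :
    cardOf (fun x : Fin k × Fin n =>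
      x.1 ≤ a ∧ T.EnterBelow a x ∧ T.entry x ≤ T.entry (a, c)) ≤
    cardOf (fun y : Fin k × Fin n =>
      a < y.1 ∧ T.ExitAbove b y ∧ T.entry y < T.entry (b, c)) := by
  have h1 : ∀ x, T.EnterBelow a x → ∃ y, (T.entry y).val + 1 = T.entry x ∧ a < y.1 :=
    fun _ hx => hx
  choose! f hf using h1
  refine cardOf_le_of_injOn f ?_ ?_
  · rintro x ⟨hxa, hx, hxc⟩
    have h1 := hf x hx
    refine ⟨h1.2, ⟨x, h1.1, ?_⟩, ?_⟩
    · rw [Fin.le_def] at hxa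
      rw [Fin.lt_def]
      omega
    · have h3 := hxc.trans_lt (T.col_lt a b c (by rw [Fin.lt_def]; omega))
      rw [Fin.lt_def] at h3 ⊢
      omega
  · rintro x y ⟨-, hx, -⟩ ⟨-, hy, -⟩ h
    have h1 := (hf x hx).1
    have h2 := (hf y hy).1
    rw [h] at h1
    exact T.entry.injective (Fin.ext (by omega))

theorem RectSYT.card_enterBelow_eq (T : RectSYT k n) (a b : Fin k) (hab : b.val = a.val + 1) :
    cardOf (fun x : Fin k × Fin n => x.1 ≤ a ∧ T.EnterBelow a x) =
    cardOf (fun y : Fin k × Fin n => a < y.1 ∧ T.ExitAbove b y) := by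
  have h1 : ∀ x, T.EnterBelow a x → ∃ y, (T.entry y).val + 1 = T.entry x ∧ a < y.1 :=
    fun _ hx => hx
  choose! f hf using h1
  refine cardOf_eq_of_bijOn f ?_ ?_ ?_
  · rintro x ⟨hxa, hx⟩
    have h1 := hf x hx
    refine ⟨h1.2, ⟨x, h1.1, ?_⟩⟩
    rw [Fin.le_def] at hxa
    rw [Fin.lt_def]
    omega
  · rintro x y ⟨-, hx⟩ ⟨-, hy⟩ h
    have h1 := (hf x hx).1
    have h2 := (hf y hy).1
    rw [h] at h1
    exact T.entry.injective (Fin.ext (by omega))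
  · rintro y ⟨hya, x, hx, hxb⟩
    refine ⟨x, ⟨?_, y, hx, hya⟩, T.entry.injective (Fin.ext ?_)⟩
    · rw [Fin.lt_def] at hxb
      rw [Fin.le_def]
      omega
    · have := (hf x ⟨y, hx, hya⟩).1
      omega

theorem sum_bool_compl (f : ℕ → Bool) (m : ℕ) :
    (∑ t ∈ Finset.range m, if f t = false then 1 else 0) +
      (∑ t ∈ Finset.range m, if f t = true then 1 else 0) = m := by
  rw [← Finset.sum_add_distrib, Finset.sum_congr rfl (g := fun _ => 1)]
  · simp
  · intro t _
    cases f t <;> simp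

open Classical in
/-- Negating the cuts next to the entries of two adjacent rows is possible. -/
theorem RectSYT.exists_swap (T : RectSYT k n) (hn : 1 ≤ n) (a b : Fin k)
    (hab : b.val = a.val + 1) :
    ∃ T' : RectSYT k n,
      (∀ p q : Fin k × Fin n, (p.1 ≤ a ↔ q.1 ≤ a) →
        (T'.entry p < T'.entry q ↔ T.entry p < T.entry q)) ∧
      (∀ x : Fin k × Fin n, x.1 ≤ a → (T'.EnterBelow a x ↔
        if x.1 = a then T.startsUp b x.2 = false else T.EnterBelow a x)) ∧
      (∀ y : Fin k × Fin n, a < y.1 → (T'.ExitAbove b y ↔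
        if y.1 = b then T.endsDown a (y.2.val + 1) = false else T.ExitAbove b y)) := by
  have hlt : a < b := by rw [Fin.lt_def]; omega
  have hb := b.2
  obtain ⟨S, hS⟩ : ∃ S, S = T.EnterBelow a := ⟨_, rfl⟩
  obtain ⟨E, hE⟩ : ∃ E, E = T.ExitAbove b := ⟨_, rfl⟩
  have oldS : ∀ x : Fin k × Fin n, T.EnterBelow a x ↔
      if x.1 = a then T.endsDown a x.2 = true else S x := by
    rintro ⟨r, c⟩
    split_ifs with h
    · simp only at h
      rw [T.endsDown_coe, h]
    · rw [hS]
  have oldE : ∀ y : Fin k × Fin n, T.ExitAbove b y ↔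
      if y.1 = b then T.startsUp b (y.2.val + 1) = true else E y := by
    rintro ⟨r, c⟩
    split_ifs with h
    · simp only at h
      rw [T.startsUp_succ, h]
    · rw [hE]
  have su0 := T.startsUp_zero (s := b) (by omega)
  have sun := T.startsUp_top hn b
  have ed0 := T.endsDown_zero hn a
  have edn := T.endsDown_top (s := a) (by omega)
  refine T.exists_recut a b hab
    (fun x => if x.1 = a then T.startsUp b x.2 = false else T.EnterBelow a x)
    (fun y => if y.1 = b then T.endsDown a (y.2.val + 1) = false else T.ExitAbove b y)
    (fun c => ?_) ?_
  · have h := T.card_enterBelow_le a b hab c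
    have hX : ∀ P : Fin n → Prop, cardOf (fun x : Fin k × Fin n =>
        x.1 ≤ a ∧ (if x.1 = a then P x.2 else S x) ∧
          T.entry x ≤ T.entry (a, c)) = _ := fun P =>
      cardOf_split a (· ≤ a) le_rfl P S (fun x => T.entry x ≤ T.entry (a, c))
    have hY : ∀ P : Fin n → Prop, cardOf (fun y : Fin k × Fin n =>
        a < y.1 ∧ (if y.1 = b then P y.2 else E y) ∧
          T.entry y < T.entry (b, c)) = _ := fun P =>
      cardOf_split b (a < ·) hlt P E (fun y => T.entry y < T.entry (b, c))
    have hle : ∀ c', T.entry (a, c') ≤ T.entry (a, c) ↔ c'.val < c.val + 1 := fun c' => by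
      rw [← not_lt, T.row_lt_iff, not_lt, Fin.le_def, Nat.lt_succ_iff]
    have hlt' : ∀ c', T.entry (b, c') < T.entry (b, c) ↔ c'.val < c.val := fun c' => by
      rw [T.row_lt_iff, Fin.lt_def]
    simp only [oldS, oldE] at h
    rw [hX fun c' => T.endsDown a c' = true, hY fun c' => T.startsUp b (c' + 1) = true] at h
    rw [← hS, ← hE, hX fun c' => T.startsUp b c' = false, hY fun c' => T.endsDown a (c' + 1) = false]
    simp only [hle, hlt'] at h ⊢
    rw [cardOf_fin_eq_sum (T.endsDown a) true (by omega),
      cardOf_fin_eq_sum (fun t => T.startsUp b (t + 1)) true (by omega)] at h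
    rw [cardOf_fin_eq_sum (T.startsUp b) false (by omega),
      cardOf_fin_eq_sum (fun t => T.endsDown a (t + 1)) false (by omega)]
    -- Complementing both sums over the first c + 1 columns moves each to the other side of the
    -- inequality. The shift by one column is compensated by `startsUp b 0 = true` and `endsDown a 0
    -- = false`, so the new inequality is the old one.
    have h1 := sum_bool_compl (T.startsUp b) (c.val + 1)
    have h2 := sum_bool_compl (T.endsDown a) (c.val + 1)
    have h3 := Finset.sum_range_succ' (fun t => if T.startsUp b t = true then 1 else 0) c.val
    have h4 := Finset.sum_range_succ' (fun t => if T.endsDown a t = false then 1 else 0) c.val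
    simp only [su0, ed0, if_true] at h3 h4
    omega
  · have h := T.card_enterBelow_eq a b hab
    have hX : ∀ P : Fin n → Prop, cardOf (fun x : Fin k × Fin n =>
        x.1 ≤ a ∧ (if x.1 = a then P x.2 else S x)) = _ := fun P => by
      simpa only [and_true] using
        cardOf_split a (· ≤ a) le_rfl P S (fun _ => True)
    have hY : ∀ P : Fin n → Prop, cardOf (fun y : Fin k × Fin n =>
        a < y.1 ∧ (if y.1 = b then P y.2 else E y)) = _ := fun P => by
      simpa only [and_true] using
        cardOf_split b (a < ·) hlt P E (fun _ => True)
    have hc : ∀ (f : ℕ → Bool) (v : Bool), cardOf (fun c : Fin n => f c = v) =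
        ∑ t ∈ Finset.range n, if f t = v then 1 else 0 := fun f v => by
      simpa using cardOf_fin_eq_sum f v (le_refl n)
    simp only [oldS, oldE] at h
    rw [hX fun c' => T.endsDown a c' = true, hY fun c' => T.startsUp b (c' + 1) = true,
      hc (T.endsDown a) true, hc (fun t => T.startsUp b (t + 1)) true] at h
    rw [← hS, ← hE, hX fun c' => T.startsUp b c' = false, hY fun c' => T.endsDown a (c' + 1) = false,
      hc (T.startsUp b) false, hc (fun t => T.endsDown a (t + 1)) false]
    -- The same computation for all columns; the boundary values in column n now enter as well.
    have h1 := sum_bool_compl (T.startsUp b) n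
    have h2 := sum_bool_compl (T.endsDown a) n
    have h3 := Finset.sum_range_succ' (fun t => if T.startsUp b t = true then 1 else 0) n
    have h4 := Finset.sum_range_succ' (fun t => if T.endsDown a t = false then 1 else 0) n
    rw [Finset.sum_range_succ] at h3 h4
    simp only [su0, ed0, sun, edn, if_true, Bool.false_eq_true, Bool.true_eq_false,
      if_false] at h3 h4
    omega

/-! ### The effect of recutting on the encoding -/

/-- The entry of `q` is the next one after that of `p` in a row satisfying `R`. -/
def RectSYT.NextIn (T : RectSYT k n) (R : Fin k → Prop) (p q : Fin k × Fin n) : Prop :=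
  T.entry p < T.entry q ∧ ∀ z : Fin k × Fin n, R z.1 → T.entry p < T.entry z → T.entry q ≤ T.entry z

theorem RectSYT.nextIn_congr {T T' : RectSYT k n} {R : Fin k → Prop}
    (h : ∀ p q : Fin k × Fin n, R p.1 → R q.1 → (T'.entry p < T'.entry q ↔ T.entry p < T.entry q))
    {p q : Fin k × Fin n} (hp : R p.1) (hq : R q.1) : T'.NextIn R p q ↔ T.NextIn R p q := by
  refine and_congr (h p q hp hq) (forall_congr' fun z => forall_congr' fun hz => ?_)
  rw [h p z hp hz, ← not_lt, h z q hz hq, not_lt]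

theorem RectSYT.NextIn.le {T : RectSYT k n} {R : Fin k → Prop} {p q z : Fin k × Fin n}
    (h : T.NextIn R p q) (hz : R z.1) (hzq : T.entry z < T.entry q) : T.entry z ≤ T.entry p :=
  le_of_not_gt fun h' => (h.2 z hz h').not_gt hzq

theorem RectSYT.nextIn_of_succ {T : RectSYT k n} {p q : Fin k × Fin n}
    (h : (T.entry p).val + 1 = T.entry q) (R : Fin k → Prop) : T.NextIn R p q := by
  refine ⟨by rw [Fin.lt_def]; omega, fun z _ hz => ?_⟩
  rw [Fin.lt_def] at hz
  rw [Fin.le_def]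
  omega

/-- If the preceding cell among the upper rows lies below `s`, so does the true predecessor, be it
that cell or one of the lower rows. Thus only the cut before `x` and the upper order matter. -/
theorem RectSYT.enterBelow_iff_upper (T : RectSYT k n) {a s : Fin k} (hs : s ≤ a)
    (x : Fin k × Fin n) :
    T.EnterBelow s x ↔ T.EnterBelow a x ∨
      ∃ z : Fin k × Fin n, z.1 ≤ a ∧ s < z.1 ∧ T.NextIn (· ≤ a) z x := by
  constructor
  · rintro ⟨q, hq, hsq⟩
    rcases le_or_gt q.1 a with h | h
    · exact Or.inr ⟨q, h, hsq, T.nextIn_of_succ hq _⟩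
    · exact Or.inl ⟨q, hq, h⟩
  · rintro (⟨q, hq, h⟩ | ⟨z, hza, hsz, hz⟩)
    · exact ⟨q, hq, hs.trans_lt h⟩
    · obtain ⟨q, hq⟩ := T.exists_pred hz.1
      refine ⟨q, hq, ?_⟩
      rcases le_or_gt q.1 a with h | h
      · have h1 := hz.le h (by rw [Fin.lt_def]; omega)
        have h2 := hz.1
        rw [Fin.lt_def] at h2
        rw [Fin.le_def] at h1
        rwa [T.entry.injective (Fin.ext (by omega) : T.entry q = T.entry z)]
      · exact hs.trans_lt h

theorem RectSYT.exitAbove_iff_lower (T : RectSYT k n) {a b s : Fin k} (hab : b.val = a.val + 1)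
    (hs : b ≤ s) (y : Fin k × Fin n) :
    T.ExitAbove s y ↔ T.ExitAbove b y ∨
      ∃ z : Fin k × Fin n, a < z.1 ∧ z.1 < s ∧ T.NextIn (a < ·) y z := by
  have hb : ∀ r : Fin k, ¬ a < r → r < b := fun r h => by
    rw [Fin.lt_def] at h ⊢; omega
  constructor
  · rintro ⟨q, hq, hsq⟩
    by_cases h : a < q.1
    · exact Or.inr ⟨q, h, hsq, T.nextIn_of_succ hq _⟩
    · exact Or.inl ⟨q, hq, hb _ h⟩
  · rintro (⟨q, hq, h⟩ | ⟨z, hza, hsz, hz⟩)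
    · exact ⟨q, hq, h.trans_le hs⟩
    · obtain ⟨q, hq⟩ := T.exists_succ hz.1
      refine ⟨q, hq, ?_⟩
      by_cases h : a < q.1
      · have h1 := hz.2 q h (by rw [Fin.lt_def]; omega)
        have h2 := hz.1
        rw [Fin.lt_def] at h2
        rw [Fin.le_def] at h1
        rwa [T.entry.injective (Fin.ext (by omega) : T.entry q = T.entry z)]
      · exact (hb _ h).trans_le hs

/-- Within the upper rows, the next cell is the true successor unless a cut precedes it. -/
theorem RectSYT.exitAbove_iff_upper (T : RectSYT k n) {a : Fin k} (s : Fin k)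
    {x : Fin k × Fin n} (hx : x.1 ≤ a) :
    T.ExitAbove s x ↔
      ∃ z : Fin k × Fin n, z.1 < s ∧ T.NextIn (· ≤ a) x z ∧ ¬ T.EnterBelow a z := by
  constructor
  · rintro ⟨q, hq, hsq⟩
    refine ⟨q, hsq, T.nextIn_of_succ hq _, ?_⟩
    rintro ⟨z, hz, haz⟩
    rw [T.entry.injective (Fin.ext (by omega) : T.entry z = T.entry x)] at haz
    exact hx.not_gt haz
  · rintro ⟨z, hzs, hz, hne⟩
    obtain ⟨q, hq⟩ := T.exists_pred hz.1
    have hqa : q.1 ≤ a := not_lt.1 fun h => hne ⟨q, hq, h⟩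
    have h1 := hz.le hqa (by rw [Fin.lt_def]; omega)
    have h2 := hz.1
    rw [Fin.lt_def] at h2
    rw [Fin.le_def] at h1
    exact ⟨z, by omega, hzs⟩

theorem RectSYT.enterBelow_iff_lower (T : RectSYT k n) {a b : Fin k} (s : Fin k) (hab : b.val = a.val + 1)
    {y : Fin k × Fin n} (hy : a < y.1) :
    T.EnterBelow s y ↔
      ∃ z : Fin k × Fin n, s < z.1 ∧ T.NextIn (a < ·) z y ∧ ¬ T.ExitAbove b z := by
  constructor
  · rintro ⟨q, hq, hsq⟩
    refine ⟨q, hsq, T.nextIn_of_succ hq _, ?_⟩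
    rintro ⟨z, hz, haz⟩
    rw [T.entry.injective (Fin.ext (by omega) : T.entry z = T.entry y)] at haz
    rw [Fin.lt_def] at hy haz
    omega
  · rintro ⟨z, hzs, hz, hne⟩
    obtain ⟨q, hq⟩ := T.exists_succ hz.1
    have hqa : a < q.1 := by
      by_contra h
      refine hne ⟨q, hq, ?_⟩
      rw [Fin.lt_def] at h ⊢
      omega
    have h1 := hz.2 q hqa (by rw [Fin.lt_def]; omega)
    have h2 := hz.1
    rw [Fin.lt_def] at h2
    rw [Fin.le_def] at h1
    exact ⟨z, by omega, hzs⟩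

theorem RectSYT.jumps_eq (T : RectSYT k n) (s : Fin k) (c : ℕ) :
    T.jumps s c = cardOf fun p : Fin k × Fin n =>
      p.1 < s ∧ T.EnterBelow s p ∧ T.count (T.entry p) s = c :=
  (cardOf_eq_card _ (by simp)).symm

/-- A jump over row `s` can be recorded at the cell it leaves instead of the one it enters; the
count in row `s` is the same at both. This form serves the rows below the cut. -/
theorem RectSYT.jumps_eq_exit (T : RectSYT k n) (s : Fin k) (c : ℕ) :
    T.jumps s c = cardOf fun p : Fin k × Fin n =>
      s < p.1 ∧ T.ExitAbove s p ∧ T.count (T.entry p) s = c := by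
  have h1 : ∀ x, T.EnterBelow s x → ∃ y, (T.entry y).val + 1 = T.entry x ∧ s < y.1 :=
    fun _ hx => hx
  choose! f hf using h1
  have hcount : ∀ p q, (T.entry p).val + 1 = T.entry q → s < p.1 →
      T.count (T.entry p) s = T.count (T.entry q) s := by
    intro p q h hp
    rw [← h, T.count_succ_of_ne]
    rw [T.rowAt_entry]
    exact fun h => hp.ne' (Fin.ext h)
  rw [T.jumps_eq]
  refine cardOf_eq_of_bijOn f ?_ ?_ ?_
  · rintro x ⟨hxs, hx, hc⟩
    have h1 := hf x hx
    exact ⟨h1.2, ⟨x, h1.1, hxs⟩, by rw [hcount _ _ h1.1 h1.2, hc]⟩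
  · rintro x y ⟨-, hx, -⟩ ⟨-, hy, -⟩ h
    have h1 := (hf x hx).1
    have h2 := (hf y hy).1
    rw [h] at h1
    exact T.entry.injective (Fin.ext (by omega))
  · rintro y ⟨hys, ⟨x, hx, hxs⟩, hc⟩
    refine ⟨x, ⟨hxs, ⟨y, hx, hys⟩, by rw [← hcount _ _ hx hys, hc]⟩,
      T.entry.injective (Fin.ext ?_)⟩
    have := (hf x ⟨y, hx, hys⟩).1
    omega

theorem RectSYT.count_congr {T T' : RectSYT k n} {R : Fin k → Prop}
    (h : ∀ p q : Fin k × Fin n, R p.1 → R q.1 → (T'.entry p < T'.entry q ↔ T.entry p < T.entry q))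
    {p : Fin k × Fin n} (hp : R p.1) {s : Fin k} (hs : R s) :
    T'.count (T'.entry p) s = T.count (T.entry p) s := by
  unfold RectSYT.count
  refine congrArg Finset.card (Finset.filter_congr fun c _ => ?_)
  exact h (s, c) p hs hp

theorem RectSYT.startsUp_congr {T T' : RectSYT k n} {s : Fin k}
    (h : ∀ c : Fin n, T'.ExitAbove s (s, c) ↔ T.ExitAbove s (s, c)) (c : ℕ) :
    T'.startsUp s c = T.startsUp s c := by
  exact decide_eq_decide.2 (or_congr Iff.rfl (exists_congr fun c' => and_congr Iff.rfl (h c')))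

theorem RectSYT.endsDown_congr {T T' : RectSYT k n} {s : Fin k}
    (h : ∀ c : Fin n, T'.EnterBelow s (s, c) ↔ T.EnterBelow s (s, c)) (c : ℕ) :
    T'.endsDown s c = T.endsDown s c := by
  exact decide_eq_decide.2 (or_congr Iff.rfl (exists_congr fun c' => and_congr Iff.rfl (h c')))

/-- For `s ≤ a`, all data except `endsDown a` depend only on the upper order and on cuts before
cells strictly above row `a`, and both are unchanged. Rows from `b` on are dual, with `startsUp b`
as the exception. -/
theorem RectSYT.exists_data_swap (T : RectSYT k n) (hn : 1 ≤ n) (a b : Fin k)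
    (hab : b.val = a.val + 1) :
    ∃ T' : RectSYT k n, ∀ s, ∀ c ≤ n,
      T'.startsUp s c = (if s = b then !T.endsDown a c else T.startsUp s c) ∧
      T'.jumps s c = T.jumps s c ∧
      T'.endsDown s c = (if s = a then !T.startsUp b c else T.endsDown s c) := by
  obtain ⟨T', hord, hS, hE⟩ := T.exists_swap hn a b hab
  have hlt : a < b := by rw [Fin.lt_def]; omega
  have hb := b.2
  have hX : ∀ p q : Fin k × Fin n, p.1 ≤ a → q.1 ≤ a →
      (T'.entry p < T'.entry q ↔ T.entry p < T.entry q) := fun p q hp hq =>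
    hord p q (by simp [hp, hq])
  have hY : ∀ p q : Fin k × Fin n, a < p.1 → a < q.1 →
      (T'.entry p < T'.entry q ↔ T.entry p < T.entry q) := fun p q hp hq =>
    hord p q (by simp [hp.not_ge, hq.not_ge])
  have hcases : ∀ s : Fin k, s ≤ a ∨ b ≤ s := fun s => by
    rw [Fin.le_def, Fin.le_def]; omega
  have enterX : ∀ (s : Fin k) (x : Fin k × Fin n), s ≤ a → x.1 < a →
      (T'.EnterBelow s x ↔ T.EnterBelow s x) := fun s x hs hx => by
    rw [T'.enterBelow_iff_upper hs, T.enterBelow_iff_upper hs, hS x hx.le, if_neg hx.ne]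
    refine or_congr Iff.rfl (exists_congr fun z => and_congr_right fun hz =>
      and_congr_right fun _ => ?_)
    exact RectSYT.nextIn_congr (R := (· ≤ a)) hX hz hx.le
  have exitY : ∀ (s : Fin k) (y : Fin k × Fin n), b ≤ s → b < y.1 →
      (T'.ExitAbove s y ↔ T.ExitAbove s y) := fun s y hs hy => by
    rw [T'.exitAbove_iff_lower hab hs, T.exitAbove_iff_lower hab hs, hE y (hlt.trans hy),
      if_neg hy.ne']
    refine or_congr Iff.rfl (exists_congr fun z => and_congr_right fun hz =>
      and_congr_right fun _ => ?_)
    exact RectSYT.nextIn_congr (R := (a < ·)) hY (hlt.trans hy) hz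
  have exitX : ∀ (s : Fin k) (c : Fin n), s ≤ a →
      (T'.ExitAbove s (s, c) ↔ T.ExitAbove s (s, c)) := fun s c hs => by
    rw [T'.exitAbove_iff_upper s (x := (s, c)) hs, T.exitAbove_iff_upper s (x := (s, c)) hs]
    refine exists_congr fun z => and_congr_right fun hz => and_congr ?_ (not_congr ?_)
    · exact RectSYT.nextIn_congr (R := (· ≤ a)) hX hs (hz.trans_le hs).le
    · exact enterX a z le_rfl (hz.trans_le hs)
  have enterY : ∀ (s : Fin k) (c : Fin n), b ≤ s →
      (T'.EnterBelow s (s, c) ↔ T.EnterBelow s (s, c)) := fun s c hs => by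
    rw [T'.enterBelow_iff_lower s (y := (s, c)) hab (hlt.trans_le hs),
      T.enterBelow_iff_lower s (y := (s, c)) hab (hlt.trans_le hs)]
    refine exists_congr fun z => and_congr_right fun hz => and_congr ?_ (not_congr ?_)
    · exact RectSYT.nextIn_congr (R := (a < ·)) hY (hlt.trans_le (hs.trans hz.le))
        (hlt.trans_le hs)
    · exact exitY b z le_rfl (hs.trans_lt hz)
  refine ⟨T', fun s c hc => ⟨?_, ?_, ?_⟩⟩
  · split_ifs with h
    · subst h
      rcases c with - | c
      · rw [T'.startsUp_zero (by omega), T.endsDown_zero hn, Bool.not_false]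
      · rw [Bool.eq_iff_iff, T'.startsUp_succ s ⟨c, hc⟩, hE _ hlt, if_pos rfl, Bool.not_eq_true']
    · rcases hcases s with hs | hs
      · exact RectSYT.startsUp_congr (fun c => exitX s c hs) c
      · have hs' : b < s := lt_of_le_of_ne hs (Ne.symm h)
        exact RectSYT.startsUp_congr (fun c => exitY s (s, c) hs hs') c
  · rcases hcases s with hs | hs
    · rw [T'.jumps_eq, T.jumps_eq]
      congr 1
      ext p
      refine and_congr_right fun hp => ?_
      have hpa := hp.trans_le hs
      rw [enterX s p hs hpa, RectSYT.count_congr (R := (· ≤ a)) hX hpa.le hs]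
    · rw [T'.jumps_eq_exit, T.jumps_eq_exit]
      congr 1
      ext p
      refine and_congr_right fun hp => ?_
      have hpb := hs.trans_lt hp
      rw [exitY s p hs hpb,
        RectSYT.count_congr (R := (a < ·)) hY (hlt.trans hpb) (hlt.trans_le hs)]
  · split_ifs with h
    · subst h
      rcases lt_or_eq_of_le hc with hc | rfl
      · rw [Bool.eq_iff_iff, T'.endsDown_coe s ⟨c, hc⟩, hS _ le_rfl, if_pos rfl,
          Bool.not_eq_true']
      · rw [T'.endsDown_top (by omega), T.startsUp_top hn, Bool.not_false]
    · rcases hcases s with hs | hs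
      · have hs' : s < a := lt_of_le_of_ne hs h
        exact RectSYT.endsDown_congr (fun c => enterX s (s, c) hs hs') c
      · exact RectSYT.endsDown_congr (fun c => enterY s c hs) c

/-! ### Action of the maps α_r on the boundary bits -/

/-- The row in position `r`. -/
def upperRow (r : Fin (k - 1)) : Fin k := ⟨r.val, by omega⟩

/-- The row below `upperRow r`. -/
def lowerRow (r : Fin (k - 1)) : Fin k := ⟨r.val + 1, by omega⟩

/-- The sequences of the array `A` are the zigzags given by `e`, `j` and `d`. -/
def ArrowArray.HasData (A : ArrowArray k n) (e : Fin k → ℕ → Bool) (j : Fin k → ℕ → ℕ)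
    (d : Fin k → ℕ → Bool) : Prop :=
  ∀ s (c : Fin (n + 1)), A s c = zigzag (e s c) (j s c) (d s c)

theorem RectSYT.hasData_encoding (hN : 0 < k * n) (T : RectSYT k n) :
    ArrowArray.HasData T.encoding T.startsUp T.jumps T.endsDown :=
  T.encoding_eq_zigzag hN

theorem upperRow_inj {r r' : Fin (k - 1)} : upperRow r = upperRow r' ↔ r = r' := by
  simp [upperRow, Fin.ext_iff]

theorem lowerRow_inj {r r' : Fin (k - 1)} : lowerRow r = lowerRow r' ↔ r = r' := by
  simp [lowerRow, Fin.ext_iff]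

theorem ArrowArray.HasData.arrayStep {A : ArrowArray k n} {e d : Fin k → ℕ → Bool}
    {j : Fin k → ℕ → ℕ} (hA : ArrowArray.HasData A e j d) (r : Fin (k - 1)) :
    ArrowArray.HasData (arrayStep r A)
      (fun s c => if s = lowerRow r then !d (upperRow r) c else e s c) j
      (fun s c => if s = upperRow r then !e (lowerRow r) c else d s c) := by
  intro s c
  have hne : upperRow r ≠ lowerRow r := by simp [upperRow, lowerRow, Fin.ext_iff]
  have hu : s.val = r.val ↔ s = upperRow r := by simp [upperRow, Fin.ext_iff]
  have hl : s.val = r.val + 1 ↔ s = lowerRow r := by simp [lowerRow, Fin.ext_iff]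
  have h : CanonPerm.arrayStep r A s c =
      if s.val = r.val then (negSwap (A (upperRow r) c) (A (lowerRow r) c)).1
      else if s.val = r.val + 1 then (negSwap (A (upperRow r) c) (A (lowerRow r) c)).2
      else A s c := rfl
  rw [h, hA, hA, hA, negSwap_zigzag]
  simp only [hu, hl]
  by_cases h3 : s = upperRow r
  · subst h3
    simp [hne]
  · by_cases h4 : s = lowerRow r
    · subst h4
      simp [hne.symm]
    · simp [h3, h4]

theorem RectSYT.exists_encoding_eq (hn : 1 ≤ n) (r : Fin (k - 1)) (T : RectSYT k n) :
    ∃ T' : RectSYT k n, T'.encoding = arrayStep r T.encoding := by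
  have hN : 0 < k * n := Nat.mul_pos (by have := r.2; omega) hn
  obtain ⟨T', h⟩ := T.exists_data_swap hn (upperRow r) (lowerRow r) rfl
  refine ⟨T', ?_⟩
  ext1 s
  ext1 c
  rw [(T.hasData_encoding hN).arrayStep r, T'.encoding_eq_zigzag hN]
  obtain ⟨h1, h2, h3⟩ := h s c (Nat.lt_succ_iff.1 c.2)
  rw [h1, h2, h3]

theorem RectSYT.existsUnique_encoding_eq (hn : 1 ≤ n) (r : Fin (k - 1)) (T : RectSYT k n) :
    ∃! T' : RectSYT k n, T'.encoding = arrayStep r T.encoding := by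
  obtain ⟨T', h⟩ := T.exists_encoding_eq hn r
  exact ⟨T', h, fun T'' h' => RectSYT.encoding_injective (h'.trans h.symm)⟩

theorem encoding_alphaStep (hn : 1 ≤ n) (r : Fin (k - 1)) (T : RectSYT k n) :
    (alphaStep r T).encoding = arrayStep r T.encoding := by
  have h := T.exists_encoding_eq hn r
  rw [alphaStep, dif_pos h]
  exact h.choose_spec

/-! ### The map `α` -/

theorem alphaStep_alphaStep (hn : 1 ≤ n) (r : Fin (k - 1)) (T : RectSYT k n) :
    alphaStep r (alphaStep r T) = T := by
  have hN : 0 < k * n := Nat.mul_pos (by have := r.2; omega) hn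
  apply RectSYT.encoding_injective
  ext1 s
  ext1 c
  rw [encoding_alphaStep hn, encoding_alphaStep hn,
    ((T.hasData_encoding hN).arrayStep r).arrayStep r, T.encoding_eq_zigzag hN]
  simp only [if_true, Bool.not_not]
  congr 1
  · split_ifs with h
    · rw [h]
    · rfl
  · split_ifs with h
    · rw [h]
    · rfl

/-- Each α_r involves only the final bits of one row and the initial bits of the next. For different
r these are disjoint, even when the pairs of rows overlap. -/
theorem alphaStep_comm (hn : 1 ≤ n) (r r' : Fin (k - 1)) (T : RectSYT k n) :
    alphaStep r (alphaStep r' T) = alphaStep r' (alphaStep r T) := by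
  rcases eq_or_ne r r' with rfl | hr
  · rfl
  have hN : 0 < k * n := Nat.mul_pos (by have := r.2; omega) hn
  apply RectSYT.encoding_injective
  ext1 s
  ext1 c
  simp only [encoding_alphaStep hn]
  rw [((T.hasData_encoding hN).arrayStep r').arrayStep r,
    ((T.hasData_encoding hN).arrayStep r).arrayStep r']
  simp only [upperRow_inj, lowerRow_inj, hr, hr.symm, if_false]
  congr 1
  · by_cases h3 : s = lowerRow r
    · simp [h3, lowerRow_inj, hr]
    · simp [h3]
  · by_cases h3 : s = upperRow r
    · simp [h3, upperRow_inj, hr]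
    · simp [h3]

theorem alpha_alpha (hn : 1 ≤ n) (T : RectSYT k n) : alpha (alpha T) = T := by
  unfold alpha
  have hcomm : ∀ (l : List (Fin (k - 1))) (r : Fin (k - 1)) (T : RectSYT k n),
      l.foldr alphaStep (alphaStep r T) = alphaStep r (l.foldr alphaStep T) := by
    intro l r
    induction l with
    | nil => exact fun _ => rfl
    | cons r' l ih =>
      intro T
      rw [List.foldr_cons, List.foldr_cons, ih, alphaStep_comm hn]
  generalize List.finRange (k - 1) = l
  induction l with
  | nil => rfl
  | cons r l ih =>
    rw [List.foldr_cons, List.foldr_cons, hcomm, alphaStep_alphaStep hn, ih]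

/-- As `l` has no repetitions, every pair of bits is switched at most once, so the result is
expressed by the bits of `T` itself. -/
theorem hasData_foldr_alphaStep (hk : 1 ≤ k) (hn : 1 ≤ n) (T : RectSYT k n)
    (l : List (Fin (k - 1))) (hl : l.Nodup) :
    ∃ e d, ArrowArray.HasData (l.foldr alphaStep T).encoding e T.jumps d ∧ ∀ r c,
      e (lowerRow r) c = (if r ∈ l then !T.endsDown (upperRow r) c else T.startsUp (lowerRow r) c) ∧
      d (upperRow r) c =
        (if r ∈ l then !T.startsUp (lowerRow r) c else T.endsDown (upperRow r) c) := by
  induction l with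
  | nil => exact ⟨_, _, T.hasData_encoding (Nat.mul_pos hk hn), by simp⟩
  | cons r l ih =>
    rw [List.nodup_cons] at hl
    obtain ⟨e, d, h, hed⟩ := ih hl.2
    rw [List.foldr_cons, encoding_alphaStep hn]
    refine ⟨_, _, h.arrayStep r, fun r' c => ?_⟩
    simp only [lowerRow_inj, upperRow_inj, List.mem_cons, (hed _ _).1, (hed _ _).2]
    by_cases hr : r' = r
    · subst hr
      simp [hl.1]
    · simp [hr]

theorem endsDown_alpha (hk : 1 ≤ k) (hn : 1 ≤ n) (T : RectSYT k n) (r : Fin (k - 1))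
    (c : Fin (n + 1)) :
    (alpha T).endsDown (upperRow r) c = !T.startsUp (lowerRow r) c := by
  obtain ⟨e, d, h, hed⟩ := hasData_foldr_alphaStep hk hn T _ (List.nodup_finRange (k - 1))
  have h1 := (hed r c).2
  rw [if_pos (List.mem_finRange r)] at h1
  have h2 : (alpha T).encoding (upperRow r) c = _ := h (upperRow r) c
  rw [RectSYT.encoding_eq_zigzag (Nat.mul_pos hk hn)] at h2
  rw [← h1, Bool.eq_iff_iff, ← getLast?_zigzag, h2, getLast?_zigzag]

/-- At (k-1)(n+1) places a final bit of α(T) is the negation of the initial bit of T below it. Each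
of the two totals exceeds the number of ascents by k - 1. -/
theorem asc_add_asc_alpha (hk : 1 ≤ k) (hn : 1 ≤ n) (T : RectSYT k n) :
    T.asc + (alpha T).asc + (k - 1) = (k - 1) * n := by
  have h1 := T.sum_startsUp
  have h2 := (alpha T).sum_endsDown
  have h3 : ∀ (r : Fin (k - 1)) (c : Fin (n + 1)),
      ((alpha T).endsDown ⟨r.val, by omega⟩ c).toNat =
      (!T.startsUp ⟨r.val + 1, by omega⟩ c).toNat := fun r c =>
    congrArg Bool.toNat (endsDown_alpha hk hn T r c)
  simp only [h3] at h2
  have h4 : (∑ r : Fin (k - 1), ∑ c : Fin (n + 1), (T.startsUp ⟨r.val + 1, by omega⟩ c).toNat) +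
      ∑ r : Fin (k - 1), ∑ c : Fin (n + 1), (!T.startsUp ⟨r.val + 1, by omega⟩ c).toNat =
      (k - 1) * (n + 1) := by
    simp_rw [← Finset.sum_add_distrib]
    rw [Finset.sum_congr rfl fun r _ => Finset.sum_congr rfl (g := fun _ => 1) fun c _ => by
      cases T.startsUp ⟨r.val + 1, by omega⟩ c <;> rfl]
    simp
  rw [h1, h2, Nat.mul_succ] at h4
  omega

/-! ### The involution on canon permutations -/

theorem canonHat_canonWord (hn : 1 ≤ n) (φ : Equiv.Perm (Fin k) → Equiv.Perm (RectSYT k n))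
    (p : Equiv.Perm (Fin k) × RectSYT k n) :
    canonHat φ (canonWord p) = canonWord (pairHat φ p) := by
  have h : ∃ q, canonWord q = canonWord p := ⟨p, rfl⟩
  rw [canonHat, dif_pos h, canonWord_injective hn h.choose_spec]

theorem pairHat_pairHat (hn : 1 ≤ n) (φ : Equiv.Perm (Fin k) → Equiv.Perm (RectSYT k n))
    (p : Equiv.Perm (Fin k) × RectSYT k n) : pairHat φ (pairHat φ p) = p := by
  obtain ⟨σ, T⟩ := p
  simp [pairHat, permCompl_permCompl, alpha_alpha hn]

/-- The inverse of φ for σ^c cancels in the descent identity, so only asc of φ_σ(T) and of its image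
under α remain, whatever the family. -/
theorem wordDes_canonHat (hk : 1 ≤ k) (hn : 1 ≤ n)
    {φ : Equiv.Perm (Fin k) → Equiv.Perm (RectSYT k n)} (hφ : IsDescentFamily φ)
    (p : Equiv.Perm (Fin k) × RectSYT k n) :
    wordDes (canonWord p) + wordDes (canonWord (pairHat φ p)) = (k - 1) * n := by
  obtain ⟨σ, T⟩ := p
  rw [pairHat, ← RectSYT.desPerm_eq, ← RectSYT.desPerm_eq, hφ, hφ, Equiv.apply_symm_apply]
  have h1 := asc_add_asc_alpha hk hn (φ σ T)
  have h2 := wordDes_add_wordDes_permCompl σ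
  simp only
  omega

theorem canonHat_spec (hk : 1 ≤ k) (hn : 1 ≤ n)
    {φ : Equiv.Perm (Fin k) → Equiv.Perm (RectSYT k n)} (hφ : IsDescentFamily φ)
    {π : Fin (k * n) → Fin k} (hπ : π ∈ canonPerms k n) :
    canonHat φ π ∈ canonPerms k n ∧ canonHat φ (canonHat φ π) = π ∧
      wordDes π + wordDes (canonHat φ π) = (k - 1) * n := by
  obtain ⟨p, rfl⟩ := exists_canonWord_eq hn hπ
  rw [canonHat_canonWord hn, canonHat_canonWord hn, pairHat_pairHat hn]
  exact ⟨canonWord_mem _ _, rfl, wordDes_canonHat hk hn hφ p⟩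

theorem canonHat_bijOn (hk : 1 ≤ k) (hn : 1 ≤ n)
    {φ : Equiv.Perm (Fin k) → Equiv.Perm (RectSYT k n)} (hφ : IsDescentFamily φ) {d : ℕ}
    (hd : d ≤ (k - 1) * n) :
    Set.BijOn (canonHat φ) {π ∈ canonPerms k n | wordDes π = d}
      {π ∈ canonPerms k n | wordDes π = (k - 1) * n - d} := by
  refine Set.InvOn.bijOn (f' := canonHat φ) ⟨fun π h => ?_, fun π h => ?_⟩ ?_ ?_
  · exact (canonHat_spec hk hn hφ h.1).2.1
  · exact (canonHat_spec hk hn hφ h.1).2.1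
  · rintro π ⟨h, h'⟩
    obtain ⟨h1, -, h3⟩ := canonHat_spec hk hn hφ h
    exact ⟨h1, by omega⟩
  · rintro π ⟨h, h'⟩
    obtain ⟨h1, -, h3⟩ := canonHat_spec hk hn hφ h
    exact ⟨h1, by omega⟩

end CanonPerm

theorem mainTheorem8 (k n : ℕ) (hk : 1 ≤ k) (hn : 1 ≤ n) :
    -- pairs `(σ, T)` correspond bijectively to canon permutations
    Set.BijOn (CanonPerm.canonWord (k := k) (n := n)) Set.univ (CanonPerm.canonPerms k n) ∧
    -- the maps `α_r` are well defined
    (∀ (r : Fin (k - 1)) (T : CanonPerm.RectSYT k n),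
      ∃! T' : CanonPerm.RectSYT k n, T'.encoding = CanonPerm.arrayStep r T.encoding) ∧
    -- families `φ_σ` as required exist
    (∃ φ : Equiv.Perm (Fin k) → Equiv.Perm (CanonPerm.RectSYT k n),
      CanonPerm.IsDescentFamily φ) ∧
    -- for each of them, `π ↦ π̂` is the map described on pairs, it is an involution on the canon
    -- permutations, and it satisfies the descent identity, hence exchanges `d` and `(k - 1) n - d`
    (∀ φ : Equiv.Perm (Fin k) → Equiv.Perm (CanonPerm.RectSYT k n),
      CanonPerm.IsDescentFamily φ →
        (∀ (σ : Equiv.Perm (Fin k)) (T : CanonPerm.RectSYT k n),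
          CanonPerm.canonHat φ (CanonPerm.canonWord (σ, T)) =
            CanonPerm.canonWord (CanonPerm.permCompl σ,
              (φ (CanonPerm.permCompl σ)).symm (CanonPerm.alpha (φ σ T)))) ∧
        (∀ π ∈ CanonPerm.canonPerms k n,
          CanonPerm.canonHat φ π ∈ CanonPerm.canonPerms k n ∧
          CanonPerm.canonHat φ (CanonPerm.canonHat φ π) = π ∧
          CanonPerm.wordDes π + CanonPerm.wordDes (CanonPerm.canonHat φ π) = (k - 1) * n) ∧
        ∀ d : ℕ, d ≤ (k - 1) * n →
          Set.BijOn (CanonPerm.canonHat φ)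
            {π ∈ CanonPerm.canonPerms k n | CanonPerm.wordDes π = d}
            {π ∈ CanonPerm.canonPerms k n | CanonPerm.wordDes π = (k - 1) * n - d}) ∧
    -- symmetry of the number of descents on canon permutations
    ∀ d : ℕ, d ≤ (k - 1) * n →
      {π ∈ CanonPerm.canonPerms k n | CanonPerm.wordDes π = d}.ncard =
        {π ∈ CanonPerm.canonPerms k n | CanonPerm.wordDes π = (k - 1) * n - d}.ncard := by
  
  obtain ⟨φ, hφ⟩ := CanonPerm.exists_isDescentFamily hk hn
  refine ⟨CanonPerm.canonWord_bijOn hn,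
    fun r T => T.existsUnique_encoding_eq hn r, ⟨φ, hφ⟩, fun φ hφ => ⟨fun σ T => ?_, fun π hπ => ?_,
      fun d hd => ?_⟩, fun d hd => ?_⟩
  · exact CanonPerm.canonHat_canonWord hn φ (σ, T)
  · exact CanonPerm.canonHat_spec hk hn hφ hπ
  · exact CanonPerm.canonHat_bijOn hk hn hφ hd
  · have h := CanonPerm.canonHat_bijOn hk hn hφ hd
    rw [← h.image_eq, h.injOn.ncard_image]
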